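/- Work in Minkowski spacetime $\mathbb{R}^{1,3}$ with $\langle x,y\rangle=-x_0y_0+x_1y_1+x_2y_2+x_3y_3$. A \emph{convex 4-polytope} is the convex hull of finitely many points, with nonempty interior; its \emph{hyperfaces} are its 3-dimensional faces, and its \emph{2d faces} are the 2-dimensional intersections of two distinct hyperfaces. It is \emph{null-faced} if every hyperface lies in a null hyperplane $\{x:\langle n,x\rangle=c\}$, with $n\neq 0$ and $\langle n,n\rangle=0$. A null hyperface of $P$ is \emph{past} (respectively \emph{future}) if $P$ lies on the future (respectively past) side of the hyperplane of this hyperface; a 2d face is past-past, past-future or future-future according to the types of the two hyperfaces that meet in it. A \emph{tessellation} is a locally finite family of convex 4-polytopes that cover $\mathbb{R}^{1,3}$ and have pairwise disjoint interiors, such that two 2d faces of tiles whose intersection is 2-dimensional are equal. (Every face-to-face tessellation, in particular every triangulation, satisfies the last condition, but a 2d face of one tile may also run through the interior of a hyperface of another one.) A \emph{tetrahedral diamond} is the convex hull of a spacelike tetrahedron and the two points $c\pm u$, where $u$ is a future-pointing timelike vector orthogonal to the tetrahedron, $c$ lies in the relative interior of the tetrahedron, and the eight hyperplanes that join a triangle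 of the tetrahedron to $c-u$ or to $c+u$ are all null (so $c$ is the centre of the inscribed sphere and $\langle u,u\rangle=-r^2$, with $r$ its radius). (i) Let $P$ be a null-faced 4-simplex. Each of its five hyperfaces is either past or future, but not both, and either two are past and three are future, or three are past and two are future. Of its ten 2d faces, exactly six are past-future; in the first case one is past-past and three are future-future, in the second case three are past-past and one is future-future. (ii) In every tessellation by null-faced convex 4-polytopes, each 2d face $F$ of a tile is a 2d face of only finitely many tiles, and the number of tiles in which $F$ is a past-future face equals the number of tiles in which $F$ is a past-past face plus the number of tiles in which $F$ is a future-future face. (iii) There is no tessellation of Minkowski spacetime all of whose tiles are null-faced 4-simplices. (iv) There is no tessellation of Minkowski spacetime all of whose tiles are tetrahedral diamonds. -/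

import Mathlib

/-- Four-dimensional Minkowski spacetime, with coordinates `(t, x, y, z) = (x 0, x 1, x 2, x 3)`. -/
abbrev Spacetime : Type := Fin 4 → ℝ

/-- The Minkowski scalar product, of signature `(-, +, +, +)`. -/
def minkowski (x y : Spacetime) : ℝ :=
  -(x 0 * y 0) + x 1 * y 1 + x 2 * y 2 + x 3 * y 3

/-- Future-pointing null vectors. -/
def IsFutureNull (n : Spacetime) : Prop := minkowski n n = 0 ∧ 0 < n 0

/-- Future-pointing timelike vectors. -/
def IsFutureTimelike (u : Spacetime) : Prop := minkowski u u < 0 ∧ 0 < u 0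

/-- The set `s` lies in some null hyperplane `{x | ⟨n, x⟩ = c}`. The normal `n` may be taken
future-pointing, since a nonzero null vector or its opposite is. -/
def LiesInNullHyperplane (s : Set Spacetime) : Prop :=
  ∃ n c, IsFutureNull n ∧ ∀ x ∈ s, minkowski n x = c

/-- The (affine) dimension of a subset of spacetime. -/
noncomputable def affDim (s : Set Spacetime) : ℕ := Module.finrank ℝ (vectorSpan ℝ s)

/-- Convex 4-polytopes: full-dimensional convex hulls of finitely many points. -/
def IsConvexPolytope (P : Set Spacetime) : Prop :=
  (∃ s : Set Spacetime, s.Finite ∧ P = convexHull ℝ s) ∧ (interior P).Nonempty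

/-- The hyperfaces of `P`: its three-dimensional exposed faces. -/
def IsHyperface (P h : Set Spacetime) : Prop := IsExposed ℝ P h ∧ affDim h = 3

/-- All hyperfaces of `P` are null. -/
def IsNullFaced (P : Set Spacetime) : Prop := ∀ h, IsHyperface P h → LiesInNullHyperplane h

/-- `h` is a null hyperface which bounds `P` from the past: `P` lies on the future side of the null
hyperplane of `h`. For a future-pointing null `n`, the scalar product `⟨n, x⟩` decreases
along future-pointing timelike directions, so the future side is `⟨n, x⟩ ≤ c`. -/
def IsPastHyperface (P h : Set Spacetime) : Prop :=
  IsHyperface P h ∧ ∃ n c, IsFutureNull n ∧ (∀ x ∈ h, minkowski n x = c) ∧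
    ∀ x ∈ P, minkowski n x ≤ c

/-- `h` is a null hyperface which bounds `P` from the future: `P` lies on the past side of the null
hyperplane of `h`. -/
def IsFutureHyperface (P h : Set Spacetime) : Prop :=
  IsHyperface P h ∧ ∃ n c, IsFutureNull n ∧ (∀ x ∈ h, minkowski n x = c) ∧
    ∀ x ∈ P, c ≤ minkowski n x

/-- `F` is the two-dimensional intersection of the two hyperfaces `h` and `k` of `P`. -/
def IsFaceBetween (P h k F : Set Spacetime) : Prop :=
  IsHyperface P h ∧ IsHyperface P k ∧ h ≠ k ∧ F = h ∩ k ∧ affDim F = 2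

/-- The 2d faces of a 4-polytope. -/
def IsTwoFace (P F : Set Spacetime) : Prop := ∃ h k, IsFaceBetween P h k F

/-- 2d faces between two past hyperfaces. -/
def IsPastPastFace (P F : Set Spacetime) : Prop :=
  ∃ h k, IsFaceBetween P h k F ∧ IsPastHyperface P h ∧ IsPastHyperface P k

/-- 2d faces between a past and a future hyperface. -/
def IsPastFutureFace (P F : Set Spacetime) : Prop :=
  ∃ h k, IsFaceBetween P h k F ∧ IsPastHyperface P h ∧ IsFutureHyperface P k

/-- 2d faces between two future hyperfaces. -/
def IsFutureFutureFace (P F : Set Spacetime) : Prop :=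
  ∃ h k, IsFaceBetween P h k F ∧ IsFutureHyperface P h ∧ IsFutureHyperface P k

/-- Null-faced 4-simplices. -/
def IsNullFacedSimplex (P : Set Spacetime) : Prop :=
  ∃ v : Fin 5 → Spacetime, AffineIndependent ℝ v ∧ P = convexHull ℝ (Set.range v) ∧ IsNullFaced P

/-- Tetrahedral diamonds: the convex hull of a spacelike base tetrahedron with vertices `b j`, an
initial vertex `c - u` and a final vertex `c + u`, where `u` is a future-pointing timelike vector
orthogonal to the base tetrahedron, `c` is a point in the relative interior of the base
tetrahedron, and, for each of the four triangles of the base tetrahedron, the hyperplanes that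
join this triangle to the initial and to the final vertex are null. (The last condition forces `c`
to be the centre of the inscribed sphere of the base tetrahedron and `u` to have the length of its
radius.) -/
def IsTetrahedralDiamond (P : Set Spacetime) : Prop :=
  ∃ (b : Fin 4 → Spacetime) (w : Fin 4 → ℝ) (c u : Spacetime),
    AffineIndependent ℝ b ∧
    IsFutureTimelike u ∧ (∀ j k, minkowski u (b j - b k) = 0) ∧
    (∀ j, 0 < w j) ∧ ∑ j, w j = 1 ∧ c = ∑ j, w j • b j ∧
    (∀ k, LiesInNullHyperplane (insert (c - u) (b '' {k}ᶜ))) ∧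
    (∀ k, LiesInNullHyperplane (insert (c + u) (b '' {k}ᶜ))) ∧
    P = convexHull ℝ (Set.range b ∪ {c - u, c + u})

/-- Tessellations of spacetime into convex 4-polytopes. Tiles need not meet face to face: a 2d face
of one tile may run through the interior of a hyperface of another one. It is only required that
2d faces of tiles do not overlap partially. -/
structure IsTessellation (𝒯 : Set (Set Spacetime)) : Prop where
  polytope : ∀ P ∈ 𝒯, IsConvexPolytope P
  cover : ⋃₀ 𝒯 = Set.univ
  disjoint : ∀ P ∈ 𝒯, ∀ Q ∈ 𝒯, P ≠ Q → Disjoint (interior P) (interior Q)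
  locallyFinite : LocallyFinite (fun P : 𝒯 => (P : Set Spacetime))
  faces : ∀ P ∈ 𝒯, ∀ Q ∈ 𝒯, ∀ F G, IsTwoFace P F → IsTwoFace Q G → affDim (F ∩ G) = 2 → F = G

/-! The balance at a 2d face is a planar count. Two non-proportional future-pointing null vectors
`n`, `m` satisfy `⟨n, m⟩ < 0`, and the only null hyperplanes through a translate of the plane
orthogonal to both are those normal to `n` and to `m` (`IsFutureNull.eq_smul_of_orthogonal`). Hence
near a generic point of a 2d face `F` every tile is bounded by at most these two hyperplanes: it
fills one of their four quadrants, a half-space or a whole neighbourhood. Count the quadrants on the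
like sides of the two hyperplanes with sign `+` and the other two with sign `-`. Half-spaces and
neighbourhoods count zero. A tile that fills one quadrant has `F` as a 2d face, because 2d faces do
not overlap partially; it counts `+1` if `F` is past-past or future-future and `-1` if it is
past-future. Each quadrant is filled by exactly one tile, so the total is `1 + 1 - 1 - 1 = 0`
(`quadrant_count`, `balance_of_isTessellation`). The finitely many half-spaces that bound a polytope
come from its polar (`IsConvexPolytope.exists_halfSpaces`).

For a simplex, the linear parts of the barycentric coordinates sum to zero, and up to sign they are
pairings with multiples `κ i • n i` of the null normals, the sign of `κ i` telling past from future.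
Pairing the sum of these multiples with `n j` kills the `j`-th term and multiplies every other `κ i`
by a negative number, so the `κ i` with `i ≠ j` have both signs (`exists_past_and_future_ne`). This
leaves the splittings 2 + 3 and 3 + 2, and 2d faces are pairs of indices.

Summed over the 2d faces at a vertex `v`, the balance says that past-future faces are exactly as
many as the others, counted over all tiles with vertex `v` (`vertex_balance`). A null-faced simplex
never has a deficit of past-future faces at a vertex, and has a surplus at one of its vertices; a
diamond has a deficit at each of its vertices. Both contradict the balance. -/

open Filter Topology

/-! ### The Minkowski form and its dual functionals -/

lemma minkowski_comm (x y : Spacetime) : minkowski x y = minkowski y x := by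
  simp only [minkowski]; ring

lemma minkowski_add_right (a x y : Spacetime) :
    minkowski a (x + y) = minkowski a x + minkowski a y := by
  simp only [minkowski, Pi.add_apply]; ring

lemma minkowski_sub_right (a x y : Spacetime) :
    minkowski a (x - y) = minkowski a x - minkowski a y := by
  simp only [minkowski, Pi.sub_apply]; ring

lemma minkowski_smul_right (r : ℝ) (a x : Spacetime) :
    minkowski a (r • x) = r * minkowski a x := by
  simp only [minkowski, Pi.smul_apply, smul_eq_mul]; ring

lemma minkowski_neg_right (a x : Spacetime) : minkowski a (-x) = -minkowski a x := by
  simp only [minkowski, Pi.neg_apply]; ring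

lemma minkowski_add_left (x y a : Spacetime) :
    minkowski (x + y) a = minkowski x a + minkowski y a := by
  simp only [minkowski, Pi.add_apply]; ring

lemma minkowski_sub_left (x y a : Spacetime) :
    minkowski (x - y) a = minkowski x a - minkowski y a := by
  simp only [minkowski, Pi.sub_apply]; ring

lemma minkowski_smul_left (r : ℝ) (x a : Spacetime) :
    minkowski (r • x) a = r * minkowski x a := by
  simp only [minkowski, Pi.smul_apply, smul_eq_mul]; ring

lemma minkowski_zero_left (a : Spacetime) : minkowski 0 a = 0 := by simp [minkowski]

/-- The linear functional `⟨a, ·⟩`. -/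
def minkowskiDual (a : Spacetime) : Spacetime →ₗ[ℝ] ℝ where
  toFun := minkowski a
  map_add' := minkowski_add_right a
  map_smul' r x := minkowski_smul_right r a x

@[simp] lemma minkowskiDual_apply (a x : Spacetime) : minkowskiDual a x = minkowski a x := rfl

lemma minkowski_sum_right {ι : Type*} (s : Finset ι) (a : Spacetime) (f : ι → Spacetime) :
    minkowski a (∑ i ∈ s, f i) = ∑ i ∈ s, minkowski a (f i) :=
  map_sum (minkowskiDual a) f s

@[fun_prop] lemma continuous_minkowski_right (a : Spacetime) : Continuous (minkowski a) := by
  unfold minkowski; fun_prop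

@[fun_prop] lemma continuous_minkowski_left (a : Spacetime) :
    Continuous (fun x => minkowski x a) := by
  unfold minkowski; fun_prop

/-- The continuous linear functional `⟨a, ·⟩`. -/
def minkowskiStrongDual (a : Spacetime) : StrongDual ℝ Spacetime :=
  ⟨minkowskiDual a, continuous_minkowski_right a⟩

@[simp] lemma minkowskiStrongDual_apply (a x : Spacetime) :
    minkowskiStrongDual a x = minkowski a x := rfl

lemma exists_eq_minkowski (l : Spacetime →ₗ[ℝ] ℝ) : ∃ a, ∀ x, l x = minkowski a x := by
  refine ⟨![-l (Pi.single 0 1), l (Pi.single 1 1), l (Pi.single 2 1), l (Pi.single 3 1)],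
    fun x => ?_⟩
  have h := l.pi_apply_eq_sum_univ x
  have e : ∀ i : Fin 4, (fun j => if i = j then (1 : ℝ) else 0) = Pi.single i 1 := by
    intro i; ext j; simp [Pi.single_apply, eq_comm]
  simp only [e, Fin.sum_univ_four, smul_eq_mul] at h
  rw [h]; simp [minkowski]; ring

lemma eq_zero_of_minkowski_eq_zero {a : Spacetime} (h : ∀ x, minkowski a x = 0) : a = 0 := by
  ext i
  have := h (Pi.single i 1)
  fin_cases i <;> simpa [minkowski, Pi.single_apply] using this

lemma minkowskiDual_ne_zero {a : Spacetime} (ha : a ≠ 0) : minkowskiDual a ≠ 0 := fun h =>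
  ha (eq_zero_of_minkowski_eq_zero fun x => by simpa using LinearMap.congr_fun h x)

lemma finrank_ker_minkowskiDual {a : Spacetime} (ha : a ≠ 0) :
    Module.finrank ℝ (LinearMap.ker (minkowskiDual a)) = 3 := by
  have h := (minkowskiDual a).finrank_range_add_finrank_ker
  rw [LinearMap.range_eq_top.2 (LinearMap.surjective (minkowskiDual_ne_zero ha)), finrank_top]
    at h
  simp at h; omega

/-! ### Null vectors and spacelike planes -/

lemma IsFutureNull.ne_zero {n : Spacetime} (h : IsFutureNull n) : n ≠ 0 := by
  rintro rfl; simpa using h.2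

/-- With arrows for spatial parts, nullness of `n` gives `|u₀n⃗ - n₀u⃗|² = n₀²⟨u,u⟩ - 2n₀u₀⟨n,u⟩`;
the right side would be negative if `⟨n,u⟩ ≥ 0`. -/
lemma IsFutureNull.minkowski_neg_of_timelike {n u : Spacetime} (hn : IsFutureNull n)
    (hu : IsFutureTimelike u) : minkowski n u < 0 := by
  obtain ⟨h1, h2⟩ := hn
  obtain ⟨h3, h4⟩ := hu
  simp only [minkowski] at *
  have hp : 0 < n 0 * u 0 := mul_pos h2 h4
  have hq : 0 < n 0 * n 0 := mul_pos h2 h2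
  by_contra! hc
  have := mul_nonneg hp.le hc
  have := mul_pos hq (neg_pos.2 h3)
  nlinarith [sq_nonneg (u 0 * n 1 - n 0 * u 1), sq_nonneg (u 0 * n 2 - n 0 * u 2),
    sq_nonneg (u 0 * n 3 - n 0 * u 3), mul_self_nonneg (u 0)]

/-- For null `n`, `m` one has `|m₀n⃗ - n₀m⃗|² = -2n₀m₀⟨n,m⟩`, so a nonnegative product forces the
two vectors to be proportional. -/
lemma IsFutureNull.minkowski_neg {n m : Spacetime} (hn : IsFutureNull n) (hm : IsFutureNull m)
    (h : ∀ κ : ℝ, m ≠ κ • n) : minkowski n m < 0 := by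
  by_contra! hc
  refine h (m 0 / n 0) ?_
  have h0 : n 0 ≠ 0 := hn.2.ne'
  obtain ⟨h1, h2⟩ := hn
  obtain ⟨h3, h4⟩ := hm
  have hp : 0 ≤ (n 0 * m 0) * minkowski n m := mul_nonneg (mul_pos h2 h4).le hc
  simp only [minkowski] at *
  have key : (m 0 * n 1 - n 0 * m 1) ^ 2 + (m 0 * n 2 - n 0 * m 2) ^ 2
      + (m 0 * n 3 - n 0 * m 3) ^ 2 ≤ 0 := by
    have e1 : m 0 ^ 2 * (-(n 0 * n 0) + n 1 * n 1 + n 2 * n 2 + n 3 * n 3) = 0 := by rw [h1]; ring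
    have e2 : n 0 ^ 2 * (-(m 0 * m 0) + m 1 * m 1 + m 2 * m 2 + m 3 * m 3) = 0 := by rw [h3]; ring
    nlinarith
  have k1 : m 0 * n 1 - n 0 * m 1 = 0 := by
    nlinarith [sq_nonneg (m 0 * n 1 - n 0 * m 1), sq_nonneg (m 0 * n 2 - n 0 * m 2),
      sq_nonneg (m 0 * n 3 - n 0 * m 3)]
  have k2 : m 0 * n 2 - n 0 * m 2 = 0 := by
    nlinarith [sq_nonneg (m 0 * n 1 - n 0 * m 1), sq_nonneg (m 0 * n 2 - n 0 * m 2),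
      sq_nonneg (m 0 * n 3 - n 0 * m 3)]
  have k3 : m 0 * n 3 - n 0 * m 3 = 0 := by
    nlinarith [sq_nonneg (m 0 * n 1 - n 0 * m 1), sq_nonneg (m 0 * n 2 - n 0 * m 2),
      sq_nonneg (m 0 * n 3 - n 0 * m 3)]
  ext i
  fin_cases i <;> simp <;> field_simp <;> linarith

/-- The orthogonal complement of the plane spanned by `n` and `m`. -/
def orthogonalPlane (n m : Spacetime) : Submodule ℝ Spacetime :=
  LinearMap.ker (minkowskiDual n) ⊓ LinearMap.ker (minkowskiDual m)

lemma mem_orthogonalPlane {n m w : Spacetime} :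
    w ∈ orthogonalPlane n m ↔ minkowski n w = 0 ∧ minkowski m w = 0 := by
  simp [orthogonalPlane]

lemma finrank_orthogonalPlane {n m : Spacetime} (hn : minkowski n n = 0) (hm : minkowski m m = 0)
    (h : minkowski n m ≠ 0) : Module.finrank ℝ (orthogonalPlane n m) = 2 := by
  have hk : orthogonalPlane n m = LinearMap.ker ((minkowskiDual n).prod (minkowskiDual m)) := by
    rw [LinearMap.ker_prod]; rfl
  have hs : LinearMap.range ((minkowskiDual n).prod (minkowskiDual m)) = ⊤ := by
    rw [LinearMap.range_eq_top]
    rintro ⟨r, s⟩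
    -- As `n` and `m` are null, each of them contributes only to the pairing with the other one.
    refine ⟨(s / minkowski n m) • n + (r / minkowski n m) • m, ?_⟩
    simp [minkowski_add_right, minkowski_smul_right, hn, hm, minkowski_comm m n, h]
  have := ((minkowskiDual n).prod (minkowskiDual m)).finrank_range_add_finrank_ker
  rw [hs, finrank_top, ← hk] at this
  simp at this; omega

/-- The double orthogonal complement puts `k` into the span of `n` and `m`, and `⟨αn + βm, αn + βm⟩
= 2αβ⟨n,m⟩` leaves only the two null directions there. -/
lemma IsFutureNull.eq_smul_of_orthogonal {n m k : Spacetime} (hn : IsFutureNull n)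
    (hm : IsFutureNull m) (hk : IsFutureNull k) (h : minkowski n m ≠ 0)
    (ho : ∀ w ∈ orthogonalPlane n m, minkowski k w = 0) :
    ∃ κ : ℝ, 0 < κ ∧ (k = κ • n ∨ k = κ • m) := by
  have hmn : minkowski m n = minkowski n m := minkowski_comm m n
  set α := minkowski m k / minkowski n m with hα
  set β := minkowski n k / minkowski n m with hβ
  have hd : k - α • n - β • m ∈ orthogonalPlane n m := by
    rw [mem_orthogonalPlane]
    simp only [minkowski_sub_right, minkowski_smul_right, hn.1, hm.1, hmn, hα, hβ]
    constructor <;> field_simp <;> ring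
  have hz : k - α • n - β • m = 0 := by
    refine eq_zero_of_minkowski_eq_zero fun x => ?_
    set γ := minkowski m x / minkowski n m with hγ
    set δ := minkowski n x / minkowski n m with hδ
    have hw : x - γ • n - δ • m ∈ orthogonalPlane n m := by
      rw [mem_orthogonalPlane]
      simp only [minkowski_sub_right, minkowski_smul_right, hn.1, hm.1, hmn, hγ, hδ]
      constructor <;> field_simp <;> ring
    have e1 : minkowski (k - α • n - β • m) (x - γ • n - δ • m) = 0 := by
      have h1 := ho _ hw
      rw [mem_orthogonalPlane] at hw
      simp only [minkowski_sub_left, minkowski_smul_left, h1, hw.1, hw.2]; ring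
    rw [mem_orthogonalPlane, minkowski_comm, minkowski_comm m] at hd
    rw [minkowski_sub_right, minkowski_sub_right, minkowski_smul_right, minkowski_smul_right,
      hd.1, hd.2] at e1
    linarith
  have hk' : k = α • n + β • m := by rw [sub_sub, sub_eq_zero] at hz; exact hz
  have h0 : minkowski k k = 2 * (α * β) * minkowski n m := by
    rw [hk']
    simp only [minkowski_add_left, minkowski_add_right, minkowski_smul_left,
      minkowski_smul_right, hn.1, hm.1, hmn]; ring
  rw [hk.1] at h0
  have hαβ : α = 0 ∨ β = 0 := by
    rcases mul_eq_zero.1 h0.symm with h | h'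
    · simpa using h
    · exact absurd h' h
  have ht := hk.2
  rcases hαβ with h | h
  · rw [h, zero_smul, zero_add] at hk'
    refine ⟨β, ?_, Or.inr hk'⟩
    rw [hk'] at ht
    exact pos_of_mul_pos_left (by simpa using ht) hm.2.le
  · rw [h, zero_smul, add_zero] at hk'
    refine ⟨α, ?_, Or.inl hk'⟩
    rw [hk'] at ht
    exact pos_of_mul_pos_left (by simpa using ht) hn.2.le

lemma exists_smul_eq_of_ker_le {a n : Spacetime} (ha : a ≠ 0)
    (h : LinearMap.ker (minkowskiDual n) ≤ LinearMap.ker (minkowskiDual a)) :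
    ∃ κ : ℝ, κ ≠ 0 ∧ a = κ • n := by
  have hm := mem_span_of_iInf_ker_le_ker (L := fun _ : Unit => minkowskiDual n)
    (K := minkowskiDual a) (by simpa using h)
  rw [Set.range_const, Submodule.mem_span_singleton] at hm
  obtain ⟨κ, hκ⟩ := hm
  have e : a = κ • n := by
    refine sub_eq_zero.1 (eq_zero_of_minkowski_eq_zero fun x => ?_)
    have := LinearMap.congr_fun hκ x
    simp only [LinearMap.smul_apply, minkowskiDual_apply, smul_eq_mul] at this
    rw [minkowski_sub_left, minkowski_smul_left, this, sub_self]
  refine ⟨κ, ?_, e⟩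
  rintro rfl
  simp [ha] at e

/-! ### Hyperfaces and their hyperplanes -/

lemma vectorSpan_le_ker {s : Set Spacetime} {a : Spacetime} {m : ℝ}
    (h : ∀ x ∈ s, minkowski a x = m) : vectorSpan ℝ s ≤ LinearMap.ker (minkowskiDual a) := by
  rw [vectorSpan, Submodule.span_le]
  rintro _ ⟨x, hx, y, hy, rfl⟩
  simp [minkowski_sub_right, h x hx, h y hy]

lemma vectorSpan_eq_ker {s : Set Spacetime} (hs : affDim s = 3) {a : Spacetime} (ha : a ≠ 0)
    {m : ℝ} (h : ∀ x ∈ s, minkowski a x = m) :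
    vectorSpan ℝ s = LinearMap.ker (minkowskiDual a) :=
  Submodule.eq_of_le_of_finrank_eq (vectorSpan_le_ker h)
    (by rw [finrank_ker_minkowskiDual ha]; exact hs)

lemma nonempty_of_affDim_pos {s : Set Spacetime} (h : 0 < affDim s) : s.Nonempty := by
  rw [Set.nonempty_iff_ne_empty]
  rintro rfl
  rw [affDim, vectorSpan_empty, finrank_bot] at h
  omega

/-- A three-dimensional set spans only one hyperplane. -/
lemma hyperplane_unique {s : Set Spacetime} (hs : affDim s = 3) {a n : Spacetime} (ha : a ≠ 0)
    (hn : n ≠ 0) {m c : ℝ} (h : ∀ x ∈ s, minkowski a x = m) (h' : ∀ x ∈ s, minkowski n x = c) :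
    ∃ κ : ℝ, κ ≠ 0 ∧ a = κ • n ∧ m = κ * c := by
  obtain ⟨κ, hκ, e⟩ := exists_smul_eq_of_ker_le (a := a) (n := n) ha
    (by rw [← vectorSpan_eq_ker hs ha h, ← vectorSpan_eq_ker hs hn h'])
  obtain ⟨x, hx⟩ := nonempty_of_affDim_pos (s := s) (by omega)
  exact ⟨κ, hκ, e, by rw [← h x hx, ← h' x hx, e, minkowski_smul_left]⟩

lemma affDim_eq_four {s : Set Spacetime} (h : (interior s).Nonempty) : affDim s = 4 := by
  have h1 : affineSpan ℝ s = ⊤ := by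
    refine top_unique ?_
    rw [← isOpen_interior.affineSpan_eq_top h]
    exact affineSpan_mono ℝ interior_subset
  rw [affDim, ← direction_affineSpan, h1, AffineSubspace.direction_top, finrank_top]
  simp

lemma eq_zero_of_interior {s : Set Spacetime} (h : (interior s).Nonempty) {a : Spacetime} {m : ℝ}
    (hs : ∀ x ∈ s, minkowski a x = m) : a = 0 := by
  by_contra ha
  have h1 := Submodule.finrank_mono (vectorSpan_le_ker hs)
  rw [finrank_ker_minkowskiDual ha] at h1
  have h2 := affDim_eq_four h
  rw [affDim] at h2
  omega

lemma isExposed_of_le {P : Set Spacetime} {a : Spacetime} {m : ℝ}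
    (h : ∀ x ∈ P, minkowski a x ≤ m) : IsExposed ℝ P {x ∈ P | minkowski a x = m} := by
  rintro ⟨z, hz, hzm⟩
  refine ⟨minkowskiStrongDual a, ?_⟩
  ext x
  simp only [Set.mem_ofPred_eq, minkowskiStrongDual_apply]
  refine and_congr_right fun hx => ⟨fun e y hy => e ▸ h y hy, fun e => le_antisymm (h x hx) ?_⟩
  rw [← hzm]; exact e z hz

lemma IsHyperface.exists_normal {P h : Set Spacetime} (hh : IsHyperface P h)
    (hP : (interior P).Nonempty) :
    ∃ a m, a ≠ 0 ∧ (∀ x ∈ P, minkowski a x ≤ m) ∧ h = {x ∈ P | minkowski a x = m} := by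
  -- The empty set is exposed vacuously; dimension 3 excludes it.
  obtain ⟨z, hz⟩ := nonempty_of_affDim_pos (s := h) (by rw [hh.2]; norm_num)
  obtain ⟨l, hl⟩ := hh.1 ⟨z, hz⟩
  obtain ⟨a, ha⟩ := exists_eq_minkowski l.toLinearMap
  simp only [ContinuousLinearMap.coe_coe] at ha
  simp only [ha] at hl
  have hle : ∀ x ∈ P, minkowski a x ≤ minkowski a z := by rw [hl] at hz; exact hz.2
  have e : h = {x ∈ P | minkowski a x = minkowski a z} := by
    rw [hl]
    ext x
    refine and_congr_right fun hx => ⟨fun e => ?_, fun e y hy => e ▸ hle y hy⟩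
    exact le_antisymm (hle x hx) (e z (hh.1.subset hz))
  refine ⟨a, minkowski a z, ?_, hle, e⟩
  rintro rfl
  have h1 : h = P := by rw [e]; simp [minkowski_zero_left]
  have h2 := hh.2
  rw [h1, affDim_eq_four hP] at h2
  omega

/-- A hyperface spans a single hyperplane, so `n` is a multiple of its supporting normal; the sign
of the factor decides on which side `P` lies. -/
lemma IsHyperface.eq_inter {P h : Set Spacetime} (hh : IsHyperface P h)
    (hP : (interior P).Nonempty) {n : Spacetime} (hn : n ≠ 0) {c : ℝ}
    (hc : ∀ x ∈ h, minkowski n x = c) :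
    h = {x ∈ P | minkowski n x = c} ∧
      ((∀ x ∈ P, minkowski n x ≤ c) ∨ ∀ x ∈ P, c ≤ minkowski n x) := by
  obtain ⟨a, m, ha, hle, e⟩ := hh.exists_normal hP
  have hm : ∀ x ∈ h, minkowski a x = m := by rw [e]; exact fun x hx => hx.2
  obtain ⟨κ, hκ, e1, e2⟩ := hyperplane_unique hh.2 hn ha hc hm
  subst e1 e2
  simp only [minkowski_smul_left]
  refine ⟨by rw [e]; simp [hκ], ?_⟩
  rcases hκ.lt_or_gt with hk | hk
  · exact Or.inr fun x hx => mul_le_mul_of_nonpos_left (hle x hx) hk.le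
  · exact Or.inl fun x hx => mul_le_mul_of_nonneg_left (hle x hx) hk.le

lemma pos_of_future_smul {a n : Spacetime} (hn : IsFutureNull n) (ha : IsFutureNull a) {κ : ℝ}
    (e : a = κ • n) : 0 < κ := by
  have := ha.2
  rw [e] at this
  exact pos_of_mul_pos_left (by simpa using this) hn.2.le

/-- Future-pointing normals of the same hyperplane differ by a positive factor, so `P` would be
squeezed into that hyperplane. -/
lemma not_past_and_future {P h : Set Spacetime} (hP : (interior P).Nonempty)
    (h1 : IsPastHyperface P h) (h2 : IsFutureHyperface P h) : False := by
  obtain ⟨hh, n, c, hn, hc, hle⟩ := h1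
  obtain ⟨-, n', c', hn', hc', hle'⟩ := h2
  obtain ⟨κ, hκ, e1, e2⟩ := hyperplane_unique hh.2 hn'.ne_zero hn.ne_zero hc' hc
  have hk := pos_of_future_smul hn hn' e1
  refine hn.ne_zero (eq_zero_of_interior hP (m := c) fun x hx => le_antisymm (hle x hx) ?_)
  have := hle' x hx
  rw [e1, e2, minkowski_smul_left] at this
  exact le_of_mul_le_mul_left this hk

lemma IsHyperface.xor_past_future {P h : Set Spacetime} (hh : IsHyperface P h)
    (hP : (interior P).Nonempty) (hl : LiesInNullHyperplane h) :
    Xor (IsPastHyperface P h) (IsFutureHyperface P h) := by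
  obtain ⟨n, c, hn, hc⟩ := hl
  rcases (hh.eq_inter hP hn.ne_zero hc).2 with h | h
  · exact Or.inl ⟨⟨hh, n, c, hn, hc, h⟩, not_past_and_future hP ⟨hh, n, c, hn, hc, h⟩⟩
  · exact Or.inr ⟨⟨hh, n, c, hn, hc, h⟩,
      fun h' => not_past_and_future hP h' ⟨hh, n, c, hn, hc, h⟩⟩

/-- The hyperfaces of a finite intersection of half-spaces are cut out by its bounding
hyperplanes. -/
lemma IsHyperface.exists_eq_inter {ι : Type*} [Finite ι] {P h : Set Spacetime}
    (hP : (interior P).Nonempty) (hconv : Convex ℝ P) (a : ι → Spacetime) (m : ι → ℝ)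
    (ha : ∀ i, a i ≠ 0) (hr : ∀ x, x ∈ P ↔ ∀ i, minkowski (a i) x ≤ m i)
    (hh : IsHyperface P h) : ∃ i, h = {x ∈ P | minkowski (a i) x = m i} := by
  suffices hs : ∃ i, ∀ x ∈ h, minkowski (a i) x = m i by
    obtain ⟨i, hi⟩ := hs
    exact ⟨i, (hh.eq_inter hP (ha i) hi).1⟩
  -- Otherwise each constraint is strict somewhere on `h`. Averaging such points gives a point of
  -- `h` at which all are strict. It is interior to `P`, so the functional exposing `h` would
  -- vanish.
  by_contra! hc
  choose y hyh hy using hc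
  have hsub := hh.1.subset
  have hconvh : Convex ℝ h := hh.1.convex hconv
  obtain ⟨z, hz⟩ := nonempty_of_affDim_pos (s := h) (by rw [hh.2]; norm_num)
  have key : ∀ s : Set ι, s.Finite → ∃ x ∈ h, ∀ i ∈ s, minkowski (a i) x < m i := by
    intro s hs
    induction s, hs using Set.Finite.induction_on with
    | empty => exact ⟨z, hz, by simp⟩
    | @insert j s _ _ ih =>
      obtain ⟨x, hx, hxs⟩ := ih
      refine ⟨(1 / 2 : ℝ) • x + (1 / 2 : ℝ) • y j,
        hconvh hx (hyh j) (by norm_num) (by norm_num) (by norm_num), ?_⟩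
      intro i hi
      have h1 := (hr x).1 (hsub hx) i
      have h2 := (hr (y j)).1 (hsub (hyh j)) i
      rw [minkowski_add_right, minkowski_smul_right, minkowski_smul_right]
      rcases hi with rfl | hi
      · have := lt_of_le_of_ne h2 (hy i)
        linarith
      · have := hxs i hi
        linarith
  obtain ⟨x, hx, hlt⟩ := key Set.univ Set.finite_univ
  have hnhds : ∀ᶠ w in nhds x, w ∈ P := by
    simp only [hr]
    rw [Filter.eventually_all]
    intro i
    exact ((continuous_minkowski_right (a i)).continuousAt.eventually_lt continuousAt_const
      (hlt i (Set.mem_univ i))).mono fun w hw => hw.le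
  obtain ⟨b, c, hb, hle, e⟩ := hh.exists_normal hP
  have hxc : minkowski b x = c := by rw [e] at hx; exact hx.2
  refine hb (eq_zero_of_minkowski_eq_zero fun d => ?_)
  have aux : ∀ d, minkowski b d ≤ 0 := by
    intro d
    have ht : Filter.Tendsto (fun t : ℝ => x + t • d) (nhdsWithin 0 (Set.Ioi 0)) (nhds x) := by
      have : Continuous (fun t : ℝ => x + t • d) := by fun_prop
      exact (this.tendsto' 0 x (by simp)).mono_left nhdsWithin_le_nhds
    obtain ⟨t, ht1, ht2⟩ := ((ht.eventually hnhds).and self_mem_nhdsWithin).exists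
    have := hle _ ht1
    rw [minkowski_add_right, minkowski_smul_right, hxc] at this
    have ht2 : 0 < t := ht2
    by_contra! hd
    have := mul_pos ht2 hd
    linarith
  refine le_antisymm (aux d) ?_
  have := aux (-d)
  rw [minkowski_neg_right] at this
  linarith

/-! ### Polytopes as intersections of half-spaces, by polarity -/

lemma le_of_mem_convexHull {s : Set Spacetime} {a : Spacetime} {m : ℝ}
    (h : ∀ v ∈ s, minkowski a v ≤ m) : ∀ x ∈ convexHull ℝ s, minkowski a x ≤ m := by
  have hc : Convex ℝ {x | minkowski a x ≤ m} :=
    convex_halfSpace_le (minkowskiDual a).isLinear m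
  exact fun x hx => convexHull_min (fun v hv => h v hv) hc hx

/-- The polar of a set with respect to the point `o` and the Minkowski scalar product. -/
def polarAt (o : Spacetime) (s : Set Spacetime) : Set Spacetime :=
  {a | ∀ v ∈ s, minkowski a (v - o) ≤ 1}

lemma polarAt_eq_iInter (o : Spacetime) (s : Set Spacetime) :
    polarAt o s = ⋂ v ∈ s, {a | minkowski a (v - o) ≤ 1} := by
  ext a; simp [polarAt]

lemma convex_polarAt (o : Spacetime) (s : Set Spacetime) : Convex ℝ (polarAt o s) := by
  rw [polarAt_eq_iInter]
  refine convex_iInter₂ fun v _ => ?_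
  simp only [minkowski_comm _ (v - o)]
  exact convex_halfSpace_le (minkowskiDual (v - o)).isLinear 1

lemma le_of_mem_polarAt {o : Spacetime} {s : Set Spacetime} {a : Spacetime}
    (ha : a ∈ polarAt o s) : ∀ x ∈ convexHull ℝ s, minkowski a x ≤ 1 + minkowski a o := by
  refine le_of_mem_convexHull fun v hv => ?_
  have := ha v hv
  rw [minkowski_sub_right] at this
  linarith

lemma isCompact_polarAt {o : Spacetime} {s : Set Spacetime}
    (ho : o ∈ interior (convexHull ℝ s)) : IsCompact (polarAt o s) := by
  refine Metric.isCompact_of_isClosed_isBounded ?_ ?_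
  · rw [polarAt_eq_iInter]
    exact isClosed_biInter fun v _ =>
      isClosed_le (continuous_minkowski_left (v - o)) continuous_const
  obtain ⟨r, hr, hball⟩ := Metric.mem_nhds_iff.1 (mem_interior_iff_mem_nhds.1 ho)
  refine (Metric.isBounded_iff_subset_closedBall 0).2 ⟨2 / r, fun a ha => ?_⟩
  rw [mem_closedBall_zero_iff, pi_norm_le_iff_of_nonneg (by positivity)]
  -- Half of `r` keeps `o + (r / 2) • d` inside the open ball, whence the bound `2 / r`.
  have key : ∀ d : Spacetime, ‖d‖ ≤ 1 → minkowski a d ≤ 2 / r := by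
    intro d hd
    have hm : o + (r / 2) • d ∈ convexHull ℝ s := by
      apply hball
      rw [mem_ball_iff_norm, add_sub_cancel_left, norm_smul, Real.norm_of_nonneg (by positivity)]
      nlinarith
    have := le_of_mem_polarAt ha _ hm
    rw [minkowski_add_right, minkowski_smul_right] at this
    rw [le_div_iff₀ hr]
    linarith
  intro i
  have hn : ‖(Pi.single i (1 : ℝ) : Spacetime)‖ ≤ 1 := by
    rw [pi_norm_le_iff_of_nonneg zero_le_one]
    intro j
    rw [Pi.single_apply]; split_ifs <;> simp
  have h1 := key (Pi.single i 1) hn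
  have h2 := key (-Pi.single i 1) (by rwa [norm_neg])
  rw [minkowski_neg_right] at h2
  rw [Real.norm_eq_abs, abs_le]
  fin_cases i <;> simp [minkowski] at h1 h2 ⊢ <;> constructor <;> linarith

/-- The points of `s` at which the constraint given by `a` is active determine an extreme point
`a` of the polar. -/
lemma eq_zero_of_mem_extremePoints_polarAt {o : Spacetime} {s : Set Spacetime} (hs : s.Finite)
    {a : Spacetime} (ha : a ∈ (polarAt o s).extremePoints ℝ) {w : Spacetime}
    (hw : ∀ v ∈ s, minkowski a (v - o) = 1 → minkowski w (v - o) = 0) : w = 0 := by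
  have key : ∀ w : Spacetime, (∀ v ∈ s, minkowski a (v - o) = 1 → minkowski w (v - o) = 0) →
      ∀ᶠ t : ℝ in nhds 0, a + t • w ∈ polarAt o s := by
    intro w hw
    have : ∀ᶠ t : ℝ in nhds 0, ∀ v ∈ s, minkowski (a + t • w) (v - o) ≤ 1 := by
      rw [hs.eventually_all]
      intro v hv
      simp only [minkowski_add_left, minkowski_smul_left]
      by_cases h1 : minkowski a (v - o) = 1
      · simp [h1, hw v hv h1]
      · have h2 : minkowski a (v - o) < 1 := lt_of_le_of_ne (ha.1 v hv) h1
        have hc : Continuous fun t : ℝ => minkowski a (v - o) + t * minkowski w (v - o) := by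
          fun_prop
        exact (hc.continuousAt.eventually_lt continuousAt_const (by simpa using h2)).mono
          fun t ht => ht.le
    exact this
  have h1 := key w hw
  have h2 := key (-w) fun v hv h => by
    rw [minkowski_comm, minkowski_neg_right, minkowski_comm, hw v hv h, neg_zero]
  obtain ⟨t, ⟨h3, h4⟩, ht⟩ :=
    (((h1.and h2).filter_mono nhdsWithin_le_nhds).and
      (self_mem_nhdsWithin : Set.Ioi (0 : ℝ) ∈ nhdsWithin 0 (Set.Ioi 0))).exists
  have ht : 0 < t := ht
  have he := (mem_extremePoints.1 ha).2 _ h3 _ h4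
    ⟨1 / 2, 1 / 2, by norm_num, by norm_num, by norm_num, by module⟩
  have := he.1
  simpa [ht.ne'] using this

/-- An extreme point of the polar is determined by its set of active constraints, a subset of the
finite set `s`. -/
lemma finite_extremePoints_polarAt (o : Spacetime) {s : Set Spacetime} (hs : s.Finite) :
    ((polarAt o s).extremePoints ℝ).Finite := by
  refine Set.Finite.of_finite_image (f := fun a => {v ∈ s | minkowski a (v - o) = 1})
    (hs.finite_subsets.subset ?_) ?_
  · rintro _ ⟨a, -, rfl⟩
    exact Set.sep_subset _ _
  · intro a ha a' ha' e
    refine sub_eq_zero.1 (eq_zero_of_mem_extremePoints_polarAt hs ha fun v hv h => ?_)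
    have h1 : v ∈ {v ∈ s | minkowski a' (v - o) = 1} := by
      have e : {v ∈ s | minkowski a (v - o) = 1} = {v ∈ s | minkowski a' (v - o) = 1} := e
      rw [← e]; exact ⟨hv, h⟩
    rw [minkowski_sub_left, h, h1.2, sub_self]

/-- Vertices of the polar correspond to facets: if the directions of the face and `v₀ - o` did not
span, a nonzero `w` orthogonal to them would vanish on all active constraints, against extremality
of `a`. -/
lemma affDim_eq_three_of_mem_extremePoints {o : Spacetime} {s : Set Spacetime} (hs : s.Finite)
    {a : Spacetime} (ha : a ∈ (polarAt o s).extremePoints ℝ) :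
    a ≠ 0 ∧ affDim {x ∈ convexHull ℝ s | minkowski a x = 1 + minkowski a o} = 3 := by
  set t := {v ∈ s | minkowski a (v - o) = 1} with ht
  set h := {x ∈ convexHull ℝ s | minkowski a x = 1 + minkowski a o} with hh
  have hth : t ⊆ h := by
    rintro v ⟨hv, e⟩
    rw [minkowski_sub_right] at e
    exact ⟨subset_convexHull ℝ s hv, by linarith⟩
  obtain ⟨v₀, hv₀⟩ : t.Nonempty := by
    by_contra hne
    rw [Set.not_nonempty_iff_eq_empty] at hne
    have := eq_zero_of_mem_extremePoints_polarAt hs ha (w := Pi.single 0 1) fun v hv e => by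
      have : v ∈ t := ⟨hv, e⟩
      simp [hne] at this
    simpa using congrFun this 0
  have ha0 : a ≠ 0 := by
    rintro rfl
    have := hv₀.2
    simp [minkowski_zero_left] at this
  refine ⟨ha0, ?_⟩
  have hle := Submodule.finrank_mono (vectorSpan_le_ker (s := h) fun x hx => hx.2)
  rw [finrank_ker_minkowskiDual ha0] at hle
  have htop : vectorSpan ℝ h ⊔ Submodule.span ℝ {v₀ - o} = ⊤ := by
    by_contra hne
    obtain ⟨f, hf, hker⟩ := Submodule.exists_le_ker_of_lt_top _ (lt_top_iff_ne_top.2 hne)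
    obtain ⟨w, hw⟩ := exists_eq_minkowski f
    have hw0 : w = 0 := by
      refine eq_zero_of_mem_extremePoints_polarAt hs ha fun v hv e => ?_
      rw [← hw, ← LinearMap.mem_ker]
      apply hker
      have : v - o = (v - v₀) + (v₀ - o) := by abel
      rw [this]
      exact Submodule.add_mem_sup (vsub_mem_vectorSpan ℝ (hth ⟨hv, e⟩) (hth hv₀))
        (Submodule.mem_span_singleton_self _)
    exact hf (LinearMap.ext fun x => by rw [hw, hw0, minkowski_zero_left]; rfl)
  have h1 := Submodule.finrank_add_le_finrank_add_finrank (vectorSpan ℝ h)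
    (Submodule.span ℝ {v₀ - o})
  rw [htop, finrank_top, Module.finrank_fin_fun] at h1
  have h2 : Module.finrank ℝ (Submodule.span ℝ {v₀ - o}) ≤ 1 :=
    (finrank_span_le_card _).trans (by simp)
  have h3 := h1.trans (Nat.add_le_add_left h2 _)
  rw [affDim]
  omega

/-- A convex polytope is the intersection of finitely many half-spaces that cut out hyperfaces. -/
theorem IsConvexPolytope.exists_halfSpaces {P : Set Spacetime} (hP : IsConvexPolytope P) :
    ∃ A : Set (Spacetime × ℝ), A.Finite ∧ (∀ x, x ∈ P ↔ ∀ g ∈ A, minkowski g.1 x ≤ g.2) ∧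
      ∀ g ∈ A, g.1 ≠ 0 ∧ IsHyperface P {x ∈ P | minkowski g.1 x = g.2} := by
  obtain ⟨⟨s, hs, rfl⟩, o, ho⟩ := hP
  refine ⟨(fun a => (a, 1 + minkowski a o)) '' (polarAt o s).extremePoints ℝ,
    (finite_extremePoints_polarAt o hs).image _, fun x => ⟨?_, fun hx => ?_⟩, ?_⟩
  · rintro hx _ ⟨a, ha, rfl⟩
    exact le_of_mem_polarAt ha.1 x hx
  · by_contra hn
    -- A functional separating `x` from the hull, rescaled, lies in the polar. By Krein–Milman it is
    -- a limit of convex combinations of extreme points, and for these the assumed inequalities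
    -- bound the pairing with `x - o` by 1.
    obtain ⟨f, u, hlt, hu⟩ := geometric_hahn_banach_closed_point (convex_convexHull ℝ s)
      (hs.isClosed_convexHull ℝ) hn
    obtain ⟨a, ha⟩ := exists_eq_minkowski f.toLinearMap
    simp only [ContinuousLinearMap.coe_coe] at ha
    have hou := hlt o (interior_subset ho)
    rw [ha] at hou hu
    have hpos : 0 < u - minkowski a o := by linarith
    have hmem : (u - minkowski a o)⁻¹ • a ∈ polarAt o s := by
      intro v hv
      have := hlt v (subset_convexHull ℝ s hv)
      rw [ha] at this
      rw [minkowski_smul_left, minkowski_sub_right, inv_mul_le_iff₀ hpos]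
      linarith
    rw [← closure_convexHull_extremePoints (isCompact_polarAt ho) (convex_polarAt o s)] at hmem
    have hsub : closure (convexHull ℝ ((polarAt o s).extremePoints ℝ)) ⊆
        {b | minkowski (x - o) b ≤ 1} := by
      refine closure_minimal (convexHull_min (fun b hb => ?_)
        (convex_halfSpace_le (minkowskiDual (x - o)).isLinear 1))
        (isClosed_le (continuous_minkowski_right _) continuous_const)
      have := hx _ ⟨b, hb, rfl⟩
      simp only [Set.mem_ofPred_eq, minkowski_comm _ b, minkowski_sub_right] at this ⊢
      linarith
    have := hsub hmem
    rw [Set.mem_ofPred_eq, minkowski_smul_right, inv_mul_le_iff₀ hpos, minkowski_comm,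
      minkowski_sub_right] at this
    linarith
  · rintro _ ⟨a, ha, rfl⟩
    obtain ⟨h0, h3⟩ := affDim_eq_three_of_mem_extremePoints hs ha
    exact ⟨h0, isExposed_of_le (le_of_mem_polarAt ha.1), h3⟩

lemma IsConvexPolytope.isCompact {P : Set Spacetime} (hP : IsConvexPolytope P) : IsCompact P := by
  obtain ⟨⟨s, hs, rfl⟩, -⟩ := hP
  exact hs.isCompact_convexHull ℝ

lemma IsConvexPolytope.convex {P : Set Spacetime} (hP : IsConvexPolytope P) : Convex ℝ P := by
  obtain ⟨⟨s, hs, rfl⟩, -⟩ := hP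
  exact convex_convexHull ℝ s

/-! ### Tiles near a generic point of a 2d face -/

/-- A point of a convex set that lies only on those of finitely many hyperplanes which contain the
whole set. -/
lemma exists_generic_point {F : Set Spacetime} (hF : Convex ℝ F) (hne : F.Nonempty)
    {A : Set (Spacetime × ℝ)} (hA : A.Finite) :
    ∃ p ∈ F, ∀ g ∈ A, minkowski g.1 p = g.2 → ∀ x ∈ F, minkowski g.1 x = g.2 := by
  induction A, hA using Set.Finite.induction_on with
  | empty => exact ⟨hne.some, hne.some_mem, by simp⟩
  | @insert g A _ hA ih =>
    obtain ⟨p, hp, hpA⟩ := ih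
    by_cases hg : minkowski g.1 p = g.2 → ∀ x ∈ F, minkowski g.1 x = g.2
    · refine ⟨p, hp, ?_⟩
      rintro g' (rfl | hg')
      exacts [hg, hpA g' hg']
    push Not at hg
    obtain ⟨hgp, q, hq, hgq⟩ := hg
    -- A short step towards `q` leaves the hyperplane of `g` and does not reach any hyperplane of
    -- `A` that misses `p`.
    have h1 : ∀ᶠ t : ℝ in 𝓝[>] 0, ∀ g' ∈ A,
        minkowski g'.1 (p + t • (q - p)) = g'.2 → ∀ x ∈ F, minkowski g'.1 x = g'.2 := by
      rw [hA.eventually_all]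
      intro g' hg'
      by_cases h : minkowski g'.1 p = g'.2
      · exact Eventually.of_forall fun t _ => hpA g' hg' h
      · have hc : Continuous fun t : ℝ => minkowski g'.1 (p + t • (q - p)) :=
          (continuous_minkowski_right g'.1).comp (by fun_prop)
        have := (hc.tendsto' 0 (minkowski g'.1 p) (by simp)).eventually_ne h
        exact (this.filter_mono nhdsWithin_le_nhds).mono fun t ht e => absurd e ht
    have h2 : ∀ᶠ t : ℝ in 𝓝[>] 0, t ∈ Set.Ioo (0 : ℝ) 1 := Ioo_mem_nhdsGT one_pos
    obtain ⟨t, ht1, ht2⟩ := (h1.and h2).exists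
    refine ⟨p + t • (q - p), hF.add_smul_sub_mem hp hq ⟨ht2.1.le, ht2.2.le⟩, ?_⟩
    rintro g' (rfl | hg') e
    · rw [minkowski_add_right, minkowski_smul_right, minkowski_sub_right, hgp] at e
      have : t * (minkowski g'.1 q - g'.2) = 0 := by linarith
      rcases mul_eq_zero.1 this with h | h
      · exact absurd h ht2.1.ne'
      · exact absurd (sub_eq_zero.1 h) hgq
    · exact ht1 g' hg' e

/-- The plane of a 2d face between two null hyperfaces. -/
lemma IsFaceBetween.eq_inter {P h k F : Set Spacetime} (hF : IsFaceBetween P h k F)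
    (hP : (interior P).Nonempty) {n m : Spacetime} {c d : ℝ} (hn : IsFutureNull n)
    (hm : IsFutureNull m) (hc : ∀ x ∈ h, minkowski n x = c) (hd : ∀ x ∈ k, minkowski m x = d) :
    minkowski n m < 0 ∧ F = {x ∈ P | minkowski n x = c ∧ minkowski m x = d} ∧
      vectorSpan ℝ F = orthogonalPlane n m := by
  obtain ⟨hh, hk, hne, rfl, h2⟩ := hF
  have e1 := (hh.eq_inter hP hn.ne_zero hc).1
  have e2 := (hk.eq_inter hP hm.ne_zero hd).1
  have hlt : minkowski n m < 0 := by
    -- Proportional normals would give parallel hyperplanes through a common point, hence `h = k`.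
    refine hn.minkowski_neg hm fun κ e => hne ?_
    obtain ⟨z, hz1, hz2⟩ := nonempty_of_affDim_pos (s := h ∩ k) (by omega)
    have hκ := pos_of_future_smul hn hm e
    have hdc : d = κ * c := by rw [← hc z hz1, ← hd z hz2, e, minkowski_smul_left]
    rw [e1, e2, e, hdc]
    simp [minkowski_smul_left, hκ.ne']
  refine ⟨hlt, ?_, ?_⟩
  · ext x
    constructor
    · exact fun hx => ⟨hh.1.subset hx.1, hc x hx.1, hd x hx.2⟩
    · rintro ⟨hx, h1, h2⟩
      exact ⟨by rw [e1]; exact ⟨hx, h1⟩, by rw [e2]; exact ⟨hx, h2⟩⟩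
  · refine Submodule.eq_of_le_of_finrank_eq (le_inf (vectorSpan_le_ker fun x hx => hc x hx.1)
      (vectorSpan_le_ker fun x hx => hd x hx.2)) ?_
    rw [finrank_orthogonalPlane hn.1 hm.1 hlt.ne]; exact h2

/-- `x` satisfies those of the two inequalities between `⟨n, ·⟩` and `c` that hold on `Q`. -/
def SameSide (Q : Set Spacetime) (n : Spacetime) (c : ℝ) (x : Spacetime) : Prop :=
  ((∀ y ∈ Q, minkowski n y ≤ c) → minkowski n x ≤ c) ∧
    ((∀ y ∈ Q, c ≤ minkowski n y) → c ≤ minkowski n x)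

lemma sameSide_of_mem {Q : Set Spacetime} {n : Spacetime} {c : ℝ} {x : Spacetime} (hx : x ∈ Q) :
    SameSide Q n c x := ⟨fun h => h x hx, fun h => h x hx⟩

lemma sameSide_of_eq {Q : Set Spacetime} {n : Spacetime} {c : ℝ} {x : Spacetime}
    (hx : minkowski n x = c) : SameSide Q n c x := ⟨fun _ => hx.le, fun _ => hx.ge⟩

/-- A null hyperplane through a spacelike 2d face is one of the two obvious ones. -/
lemma hyperplane_eq_or_eq {F : Set Spacetime} (hne : F.Nonempty) {n m k : Spacetime} {c d e : ℝ}
    (hn : IsFutureNull n) (hm : IsFutureNull m) (hk : IsFutureNull k) (hnm : minkowski n m < 0)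
    (hF : vectorSpan ℝ F = orthogonalPlane n m)
    (hFc : ∀ x ∈ F, minkowski n x = c ∧ minkowski m x = d) (hFe : ∀ x ∈ F, minkowski k x = e) :
    ∃ κ : ℝ, 0 < κ ∧ (k = κ • n ∧ e = κ * c ∨ k = κ • m ∧ e = κ * d) := by
  obtain ⟨z, hz⟩ := hne
  obtain ⟨κ, hκ, h⟩ := hn.eq_smul_of_orthogonal hm hk hnm.ne fun w hw =>
    (vectorSpan_le_ker hFe) (hF ▸ hw)
  refine ⟨κ, hκ, h.imp (fun h => ⟨h, ?_⟩) fun h => ⟨h, ?_⟩⟩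
  · rw [← hFe z hz, ← (hFc z hz).1, h, minkowski_smul_left]
  · rw [← hFe z hz, ← (hFc z hz).2, h, minkowski_smul_left]

lemma sep_smul_eq {Q : Set Spacetime} {κ c d : ℝ} {n : Spacetime} (e : d = κ * c)
    (hκ : κ ≠ 0) :
    {x ∈ Q | minkowski (κ • n) x = d} = {x ∈ Q | minkowski n x = c} := by
  simp [e, minkowski_smul_left, hκ]

/-- Near a generic point of a 2d face a null-faced polytope is bounded only by the two null
hyperplanes through this face. -/
lemma eventually_mem_of_sameSide_of_hyperface {Q F : Set Spacetime} (hnull : IsNullFaced Q)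
    {n m p : Spacetime} {c d : ℝ} (hn : IsFutureNull n) (hm : IsFutureNull m)
    (hnm : minkowski n m < 0) (hF : vectorSpan ℝ F = orthogonalPlane n m)
    (hFc : ∀ x ∈ F, minkowski n x = c ∧ minkowski m x = d) (hpF : p ∈ F) (hpQ : p ∈ Q)
    {A : Set (Spacetime × ℝ)} (hA : A.Finite)
    (hQA : ∀ x, x ∈ Q ↔ ∀ g ∈ A, minkowski g.1 x ≤ g.2)
    (hface : ∀ g ∈ A, g.1 ≠ 0 ∧ IsHyperface Q {x ∈ Q | minkowski g.1 x = g.2})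
    (hgen : ∀ g ∈ A, minkowski g.1 p = g.2 → ∀ x ∈ F, minkowski g.1 x = g.2) :
    ∀ᶠ x in 𝓝 p, (IsHyperface Q {x ∈ Q | minkowski n x = c} → SameSide Q n c x) →
      (IsHyperface Q {x ∈ Q | minkowski m x = d} → SameSide Q m d x) → x ∈ Q := by
  have key : ∀ g ∈ A, ∀ᶠ x in 𝓝 p,
      (IsHyperface Q {x ∈ Q | minkowski n x = c} → SameSide Q n c x) →
      (IsHyperface Q {x ∈ Q | minkowski m x = d} → SameSide Q m d x) →
        minkowski g.1 x ≤ g.2 := by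
    intro g hg
    -- A constraint strict at `p` stays strict nearby. An active one is active on all of `F` by
    -- genericity, so its null hyperplane contains `F` and is one of the two given ones.
    rcases ((hQA p).1 hpQ g hg).lt_or_eq with hlt | heq
    · exact ((continuous_minkowski_right g.1).continuousAt.eventually_lt continuousAt_const
        hlt).mono fun x hx _ _ => hx.le
    obtain ⟨hg0, hgf⟩ := hface g hg
    obtain ⟨k, e, hk, hke⟩ := hnull _ hgf
    obtain ⟨κ, hκ, e1, e2⟩ := hyperplane_unique hgf.2 hg0 hk.ne_zero (fun x hx => hx.2) hke
    have hle : ∀ y ∈ Q, κ * minkowski k y ≤ κ * e := fun y hy => by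
      have := (hQA y).1 hy g hg
      rwa [e1, e2, minkowski_smul_left] at this
    have hFe : ∀ x ∈ F, minkowski k x = e := fun x hx => by
      have := hgen g hg heq x hx
      rw [e1, e2, minkowski_smul_left] at this
      exact mul_left_cancel₀ hκ this
    obtain ⟨τ, hτ, h⟩ := hyperplane_eq_or_eq ⟨p, hpF⟩ hn hm hk hnm hF hFc hFe
    refine Eventually.of_forall fun x h1 h2 => ?_
    rw [e1, sep_smul_eq e2 hκ] at hgf
    rw [e1, e2, minkowski_smul_left]
    have side : ∀ {n' : Spacetime} {c' : ℝ}, k = τ • n' → e = τ * c' →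
        (IsHyperface Q {x ∈ Q | minkowski n' x = c'} → SameSide Q n' c' x) →
        κ * minkowski k x ≤ κ * e := by
      rintro n' c' rfl rfl hs
      rw [sep_smul_eq rfl hτ.ne'] at hgf
      have hs := hs hgf
      simp only [minkowski_smul_left] at hle ⊢
      rcases hκ.lt_or_gt with hk | hk
      · have := hs.2 fun y hy =>
          le_of_mul_le_mul_left ((mul_le_mul_left_of_neg hk).1 (hle y hy)) hτ
        exact mul_le_mul_of_nonpos_left (mul_le_mul_of_nonneg_left this hτ.le) hk.le
      · have := hs.1 fun y hy => le_of_mul_le_mul_left (le_of_mul_le_mul_left (hle y hy) hk) hτ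
        exact mul_le_mul_of_nonneg_left (mul_le_mul_of_nonneg_left this hτ.le) hk.le
    rcases h with ⟨ek, ee⟩ | ⟨ek, ee⟩
    · exact side ek ee h1
    · exact side ek ee h2
  filter_upwards [(hA.eventually_all).2 key] with x hx h1 h2
  exact (hQA x).2 fun g hg => hx g hg h1 h2

/-- A null hyperplane through the 2d face which supports the polytope cuts out a hyperface. -/
lemma isHyperface_of_supporting {Q : Set Spacetime} {n m p : Spacetime} {c d : ℝ}
    (hm : IsFutureNull m) (hnm : minkowski n m < 0)
    (hpn : minkowski n p = c) (hpm : minkowski m p = d)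
    (hloc : ∀ᶠ x in 𝓝 p, (IsHyperface Q {x ∈ Q | minkowski n x = c} → SameSide Q n c x) →
      (IsHyperface Q {x ∈ Q | minkowski m x = d} → SameSide Q m d x) → x ∈ Q)
    (hs : (∀ y ∈ Q, minkowski n y ≤ c) ∨ ∀ y ∈ Q, c ≤ minkowski n y) :
    IsHyperface Q {x ∈ Q | minkowski n x = c} := by
  by_contra hne
  -- If the hyperplane of `n` cuts out no hyperface, it imposes no local condition. The direction
  -- `m` stays in the hyperplane of `m`, as `m` is null, and crosses that of `n`; so `Q` would have
  -- points on both sides.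
  have key : ∀ σ : ℝ, ∀ᶠ t : ℝ in 𝓝[>] 0, p + t • (σ • m) ∈ Q := by
    intro σ
    have hc : Continuous fun t : ℝ => p + t • (σ • m) := by fun_prop
    have ht := (hc.tendsto' 0 p (by simp)).mono_left (nhdsWithin_le_nhds (s := Set.Ioi 0))
    refine (ht.eventually hloc).mono fun t ht => ht (fun h => absurd h hne) fun _ => ?_
    apply sameSide_of_eq
    rw [minkowski_add_right, minkowski_smul_right, minkowski_smul_right, hm.1, hpm]; ring
  obtain ⟨t, ⟨h1, h2⟩, ht⟩ :=
    (((key 1).and (key (-1))).and (self_mem_nhdsWithin : Set.Ioi (0 : ℝ) ∈ 𝓝[>] 0)).exists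
  have ht : 0 < t := ht
  have hneg := mul_neg_of_pos_of_neg ht hnm
  rcases hs with hs | hs
  · have := hs _ h2
    rw [minkowski_add_right, minkowski_smul_right, minkowski_smul_right, hpn] at this
    linarith
  · have := hs _ h1
    rw [minkowski_add_right, minkowski_smul_right, minkowski_smul_right, hpn] at this
    linarith

/-- Every direction of the plane, suitably shortened, is a difference of two points of `S`. -/
lemma affDim_eq_two_of_eventually {S : Set Spacetime} {n m p : Spacetime} {c d : ℝ}
    (hn : IsFutureNull n) (hm : IsFutureNull m) (hnm : minkowski n m < 0)
    (hS : ∀ x ∈ S, minkowski n x = c ∧ minkowski m x = d) (hp : p ∈ S)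
    (hloc : ∀ᶠ x in 𝓝 p, minkowski n x = c → minkowski m x = d → x ∈ S) : affDim S = 2 := by
  have : vectorSpan ℝ S = orthogonalPlane n m := by
    refine le_antisymm (le_inf (vectorSpan_le_ker fun x hx => (hS x hx).1)
      (vectorSpan_le_ker fun x hx => (hS x hx).2)) fun w hw => ?_
    rw [mem_orthogonalPlane] at hw
    have hc : Continuous fun t : ℝ => p + t • w := by fun_prop
    have ht := (hc.tendsto' 0 p (by simp)).mono_left (nhdsWithin_le_nhds (s := Set.Ioi 0))
    obtain ⟨t, h1, ht⟩ :=
      ((ht.eventually hloc).and (self_mem_nhdsWithin : Set.Ioi (0 : ℝ) ∈ 𝓝[>] 0)).exists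
    have ht : 0 < t := ht
    have h2 := h1 (by rw [minkowski_add_right, minkowski_smul_right, hw.1, (hS p hp).1]; ring)
      (by rw [minkowski_add_right, minkowski_smul_right, hw.2, (hS p hp).2]; ring)
    have h3 := vsub_mem_vectorSpan ℝ h2 hp
    rw [vsub_eq_sub, add_sub_cancel_left] at h3
    exact (Submodule.smul_mem_iff _ ht.ne').1 h3
  rw [affDim, this, finrank_orthogonalPlane hn.1 hm.1 hnm.ne]

/-- The null hyperplane of `h` contains `F`, so it is one of the two, with a positive factor that
preserves the side of `Q`. -/
lemma past_of_subset_hyperface {Q F h : Set Spacetime} (hQ : (interior Q).Nonempty)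
    (hne : F.Nonempty) {n m : Spacetime} {c d : ℝ} (hn : IsFutureNull n) (hm : IsFutureNull m)
    (hnm : minkowski n m < 0) (hF : vectorSpan ℝ F = orthogonalPlane n m)
    (hFc : ∀ x ∈ F, minkowski n x = c ∧ minkowski m x = d) (hFh : F ⊆ h)
    (hh : IsPastHyperface Q h) :
    (∀ y ∈ Q, minkowski n y ≤ c) ∧ h = {x ∈ Q | minkowski n x = c} ∨
      (∀ y ∈ Q, minkowski m y ≤ d) ∧ h = {x ∈ Q | minkowski m x = d} := by
  obtain ⟨hh, k, e, hk, hke, hle⟩ := hh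
  have hi := (hh.eq_inter hQ hk.ne_zero hke).1
  obtain ⟨κ, hκ, ⟨rfl, rfl⟩ | ⟨rfl, rfl⟩⟩ :=
    hyperplane_eq_or_eq hne hn hm hk hnm hF hFc fun x hx => hke x (hFh hx)
  · rw [sep_smul_eq rfl hκ.ne'] at hi
    simp only [minkowski_smul_left] at hle
    exact Or.inl ⟨fun y hy => le_of_mul_le_mul_left (hle y hy) hκ, hi⟩
  · rw [sep_smul_eq rfl hκ.ne'] at hi
    simp only [minkowski_smul_left] at hle
    exact Or.inr ⟨fun y hy => le_of_mul_le_mul_left (hle y hy) hκ, hi⟩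

lemma future_of_subset_hyperface {Q F h : Set Spacetime} (hQ : (interior Q).Nonempty)
    (hne : F.Nonempty) {n m : Spacetime} {c d : ℝ} (hn : IsFutureNull n) (hm : IsFutureNull m)
    (hnm : minkowski n m < 0) (hF : vectorSpan ℝ F = orthogonalPlane n m)
    (hFc : ∀ x ∈ F, minkowski n x = c ∧ minkowski m x = d) (hFh : F ⊆ h)
    (hh : IsFutureHyperface Q h) :
    (∀ y ∈ Q, c ≤ minkowski n y) ∧ h = {x ∈ Q | minkowski n x = c} ∨
      (∀ y ∈ Q, d ≤ minkowski m y) ∧ h = {x ∈ Q | minkowski m x = d} := by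
  obtain ⟨hh, k, e, hk, hke, hle⟩ := hh
  have hi := (hh.eq_inter hQ hk.ne_zero hke).1
  obtain ⟨κ, hκ, ⟨rfl, rfl⟩ | ⟨rfl, rfl⟩⟩ :=
    hyperplane_eq_or_eq hne hn hm hk hnm hF hFc fun x hx => hke x (hFh hx)
  · rw [sep_smul_eq rfl hκ.ne'] at hi
    simp only [minkowski_smul_left] at hle
    exact Or.inl ⟨fun y hy => le_of_mul_le_mul_left (hle y hy) hκ, hi⟩
  · rw [sep_smul_eq rfl hκ.ne'] at hi
    simp only [minkowski_smul_left] at hle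
    exact Or.inr ⟨fun y hy => le_of_mul_le_mul_left (hle y hy) hκ, hi⟩

/-- Near `p`, the polytope `Q` is bounded only by the hyperplanes `⟨n, x⟩ = c` and `⟨m, x⟩ = d`, and
these cut out hyperfaces if they support `Q`. -/
structure IsLocalWedge (Q : Set Spacetime) (n m p : Spacetime) (c d : ℝ) : Prop where
  eventually_mem : ∀ᶠ x in 𝓝 p, SameSide Q n c x → SameSide Q m d x → x ∈ Q
  hyperface_left : ((∀ y ∈ Q, minkowski n y ≤ c) ∨ ∀ y ∈ Q, c ≤ minkowski n y) →
    IsHyperface Q {x ∈ Q | minkowski n x = c}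
  hyperface_right : ((∀ y ∈ Q, minkowski m y ≤ d) ∨ ∀ y ∈ Q, d ≤ minkowski m y) →
    IsHyperface Q {x ∈ Q | minkowski m x = d}

/-- Near a suitable point of a 2d face `F`, all tiles are bounded only by the two null hyperplanes
through `F`. -/
lemma exists_isLocalWedge {𝒯 : Set (Set Spacetime)} (h𝒯 : IsTessellation 𝒯)
    (hnull : ∀ P ∈ 𝒯, IsNullFaced P) {F : Set Spacetime} (hcomp : IsCompact F)
    (hconv : Convex ℝ F) (hne : F.Nonempty) {n m : Spacetime} {c d : ℝ} (hn : IsFutureNull n)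
    (hm : IsFutureNull m) (hnm : minkowski n m < 0) (hF : vectorSpan ℝ F = orthogonalPlane n m)
    (hFc : ∀ x ∈ F, minkowski n x = c ∧ minkowski m x = d) :
    ∃ p ∈ F, ∀ Q ∈ 𝒯, p ∈ Q → IsLocalWedge Q n m p c d := by
  have hrep := fun Q : 𝒯 => (h𝒯.polytope Q Q.2).exists_halfSpaces
  choose A hAfin hA hAface using hrep
  -- Only finitely many tiles meet the compact set `F`, so one point can be generic for the
  -- constraints of all of them.
  have hfin : (⋃ Q ∈ {Q : 𝒯 | ((Q : Set Spacetime) ∩ F).Nonempty}, A Q).Finite :=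
    (h𝒯.locallyFinite.finite_nonempty_inter_compact hcomp).biUnion fun Q _ => hAfin Q
  obtain ⟨p, hpF, hp⟩ := exists_generic_point hconv hne hfin
  refine ⟨p, hpF, fun Q hQ hpQ => ?_⟩
  have hloc := eventually_mem_of_sameSide_of_hyperface (hnull Q hQ) hn hm hnm hF hFc
    hpF hpQ (hAfin ⟨Q, hQ⟩) (hA ⟨Q, hQ⟩) (hAface ⟨Q, hQ⟩) fun g hg =>
      hp g (Set.mem_biUnion (x := (⟨Q, hQ⟩ : 𝒯)) ⟨p, hpQ, hpF⟩ hg)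
  refine ⟨hloc.mono fun x hx h1 h2 => hx (fun _ => h1) fun _ => h2,
    isHyperface_of_supporting hm hnm (hFc p hpF).1 (hFc p hpF).2 hloc,
    isHyperface_of_supporting hn (by rwa [minkowski_comm]) (hFc p hpF).2 (hFc p hpF).1
      (hloc.mono fun x hx h1 h2 => hx h2 h1)⟩

lemma IsLocalWedge.eventually_mem_of_eq {Q : Set Spacetime} {n m p : Spacetime} {c d : ℝ}
    (hQ : IsLocalWedge Q n m p c d) :
    ∀ᶠ x in 𝓝 p, minkowski n x = c → minkowski m x = d → x ∈ Q :=
  hQ.eventually_mem.mono fun _ hx h1 h2 => hx (sameSide_of_eq h1) (sameSide_of_eq h2)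

/-- A tile supported by both null hyperplanes through a 2d face `F` has `F` as a 2d face. -/
lemma isFaceBetween_of_isLocalWedge {𝒯 : Set (Set Spacetime)} (h𝒯 : IsTessellation 𝒯)
    {P Q F : Set Spacetime} (hP : P ∈ 𝒯) (hQ : Q ∈ 𝒯) (hPF : IsTwoFace P F)
    {n m p : Spacetime} {c d : ℝ} (hn : IsFutureNull n) (hm : IsFutureNull m)
    (hnm : minkowski n m < 0) (hFe : F = {x ∈ P | minkowski n x = c ∧ minkowski m x = d})
    (hpF : p ∈ F) (hpQ : p ∈ Q) (hlP : IsLocalWedge P n m p c d) (hlQ : IsLocalWedge Q n m p c d)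
    (h1 : (∀ y ∈ Q, minkowski n y ≤ c) ∨ ∀ y ∈ Q, c ≤ minkowski n y)
    (h2 : (∀ y ∈ Q, minkowski m y ≤ d) ∨ ∀ y ∈ Q, d ≤ minkowski m y) :
    IsFaceBetween Q {x ∈ Q | minkowski n x = c} {x ∈ Q | minkowski m x = d} F := by
  have hf1 := hlQ.hyperface_left h1
  have hf2 := hlQ.hyperface_right h2
  have hpc : minkowski n p = c ∧ minkowski m p = d := by rw [hFe] at hpF; exact hpF.2
  set G := {x ∈ Q | minkowski n x = c} ∩ {x ∈ Q | minkowski m x = d} with hG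
  have hG2 : affDim G = 2 := by
    refine affDim_eq_two_of_eventually hn hm hnm (fun x hx => ⟨hx.1.2, hx.2.2⟩)
      ⟨⟨hpQ, hpc.1⟩, hpQ, hpc.2⟩ ?_
    exact hlQ.eventually_mem_of_eq.mono fun x hx e1 e2 =>
      ⟨⟨hx e1 e2, e1⟩, hx e1 e2, e2⟩
  have hGb : IsFaceBetween Q {x ∈ Q | minkowski n x = c} {x ∈ Q | minkowski m x = d} G := by
    refine ⟨hf1, hf2, fun e => ?_, rfl, hG2⟩
    rw [hG, ← e, Set.inter_self] at hG2
    have := hf1.2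
    omega
  -- Near `p` both `F` and `G` fill the plane, so they overlap in dimension two and the tessellation
  -- condition identifies them.
  have hFG : affDim (F ∩ G) = 2 := by
    refine affDim_eq_two_of_eventually hn hm hnm (fun x hx => ⟨hx.2.1.2, hx.2.2.2⟩)
      ⟨hpF, ⟨hpQ, hpc.1⟩, hpQ, hpc.2⟩ ?_
    filter_upwards [hlQ.eventually_mem_of_eq, hlP.eventually_mem_of_eq] with x hxQ hxP e1 e2
    exact ⟨by rw [hFe]; exact ⟨hxP e1 e2, e1, e2⟩, ⟨hxQ e1 e2, e1⟩, hxQ e1 e2, e2⟩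
  rw [h𝒯.faces P hP Q hQ F G hPF ⟨_, _, hGb⟩ hFG]
  exact hGb

/-- A point near `p` on neither of the two hyperplanes is in the interior of the tiles that
contain it. -/
lemma mem_interior_of_eventually {Q : Set Spacetime} {n m x : Spacetime} {c d : ℝ}
    (hx : ∀ᶠ y in 𝓝 x, SameSide Q n c y → SameSide Q m d y → y ∈ Q) (hxQ : x ∈ Q)
    (hxn : minkowski n x ≠ c) (hxm : minkowski m x ≠ d) : x ∈ interior Q := by
  rw [mem_interior_iff_mem_nhds]
  have side : ∀ {k : Spacetime} {e : ℝ}, minkowski k x ≠ e → ∀ᶠ y in 𝓝 x, SameSide Q k e y := by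
    intro k e hne
    rcases hne.lt_or_gt with h | h
    · filter_upwards [(continuous_minkowski_right k).continuousAt.eventually_lt
        continuousAt_const h] with y hy
      exact ⟨fun _ => hy.le, fun h' => absurd (h' x hxQ) (not_le.2 h)⟩
    · filter_upwards [continuousAt_const.eventually_lt
        (continuous_minkowski_right k).continuousAt h] with y hy
      exact ⟨fun h' => absurd (h' x hxQ) (not_le.2 h), fun _ => hy.le⟩
  filter_upwards [hx, side hxn, side hxm] with y hy h1 h2 using hy h1 h2

/-! ### The balance at a 2d face -/

lemma sep_finite_of_isTessellation {𝒯 : Set (Set Spacetime)} (h𝒯 : IsTessellation 𝒯)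
    (p : Spacetime) : {Q | Q ∈ 𝒯 ∧ p ∈ Q}.Finite := by
  refine ((h𝒯.locallyFinite.point_finite p).image Subtype.val).subset ?_
  rintro Q ⟨hQ, hp⟩
  exact ⟨⟨Q, hQ⟩, hp, rfl⟩

/-- The tiles are closed and locally finite, so those that miss `p` stay away from a neighbourhood
of `p`. -/
lemma eventually_mem_tile {𝒯 : Set (Set Spacetime)} (h𝒯 : IsTessellation 𝒯)
    (p : Spacetime) : ∀ᶠ x in 𝓝 p, ∀ Q ∈ 𝒯, x ∈ Q → p ∈ Q := by
  filter_upwards [h𝒯.locallyFinite.eventually_subset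
    (fun Q => (h𝒯.polytope Q Q.2).isCompact.isClosed) p] with x hx Q hQ hxQ
  exact hx (a := ⟨Q, hQ⟩) hxQ

open Classical in
/-- The number `1` if `p` holds, and `0` otherwise. -/
noncomputable def propIndicator (p : Prop) : ℕ := if p then 1 else 0

lemma sum_propIndicator {ι : Type*} (s : Finset ι) (p : ι → Prop) [DecidablePred p] :
    ∑ i ∈ s, propIndicator (p i) = (s.filter p).card := by
  rw [Finset.card_filter]
  refine Finset.sum_congr rfl fun i _ => ?_
  rw [propIndicator]
  congr

/-- `L` and `R` say that the tile lies on the `≤` or the `≥` side of a hyperplane, so `¬ R₁ ∧ ¬ R₂`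
says that it occupies the quadrant `<, <`, and so on. Up to rearrangement: a single quadrant has
signed count `±1`, while two adjacent quadrants or all four cancel. -/
lemma quadrant_count {L₁ R₁ L₂ R₂ : Prop} (h₁ : ¬ (L₁ ∧ R₁)) (h₂ : ¬ (L₂ ∧ R₂)) :
    propIndicator (L₁ ∧ L₂) + propIndicator (R₁ ∧ R₂) + propIndicator (¬ R₁ ∧ ¬ L₂) +
      propIndicator (¬ L₁ ∧ ¬ R₂) =
    propIndicator (L₁ ∧ R₂ ∨ R₁ ∧ L₂) + propIndicator (¬ R₁ ∧ ¬ R₂) +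
      propIndicator (¬ L₁ ∧ ¬ L₂) := by
  by_cases a : L₁ <;> by_cases b : R₁ <;> by_cases e : L₂ <;> by_cases f : R₂ <;>
    simp_all [propIndicator]

/-- The tiles through one generic point `p` of `F` suffice: every tile with the 2d face `F` contains
`p`, and its type is read off from the sides of the two hyperplanes on which it lies. -/
theorem balance_of_isTessellation {𝒯 : Set (Set Spacetime)} (h𝒯 : IsTessellation 𝒯)
    (hnull : ∀ P ∈ 𝒯, IsNullFaced P) {P F : Set Spacetime} (hP : P ∈ 𝒯) (hPF : IsTwoFace P F) :
    {Q | Q ∈ 𝒯 ∧ IsTwoFace Q F}.Finite ∧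
      {Q | Q ∈ 𝒯 ∧ IsPastFutureFace Q F}.ncard =
        {Q | Q ∈ 𝒯 ∧ IsPastPastFace Q F}.ncard + {Q | Q ∈ 𝒯 ∧ IsFutureFutureFace Q F}.ncard := by
  classical
  obtain ⟨h, k, hb⟩ := hPF
  have hPp := h𝒯.polytope P hP
  obtain ⟨n, c, hn, hc⟩ := hnull P hP h hb.1
  obtain ⟨m, d, hm, hd⟩ := hnull P hP k hb.2.1
  obtain ⟨hnm, hFe, hF⟩ := hb.eq_inter hPp.2 hn hm hc hd
  have hFc : ∀ x ∈ F, minkowski n x = c ∧ minkowski m x = d := by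
    rw [hFe]; exact fun x hx => hx.2
  have hne : F.Nonempty := nonempty_of_affDim_pos (by rw [hb.2.2.2.2]; norm_num)
  have hcomp : IsCompact F := by
    rw [hb.2.2.2.1]
    exact (hb.1.1.isCompact hPp.isCompact).inter (hb.2.1.1.isCompact hPp.isCompact)
  have hconv : Convex ℝ F := by
    rw [hb.2.2.2.1]
    exact (hb.1.1.convex hPp.convex).inter (hb.2.1.1.convex hPp.convex)
  obtain ⟨p, hpF, hloc⟩ := exists_isLocalWedge h𝒯 hnull hcomp hconv hne hn hm hnm hF hFc
  have hpc := hFc p hpF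
  have hfin := sep_finite_of_isTessellation h𝒯 p
  have hpQ : ∀ {Q h k}, IsFaceBetween Q h k F → p ∈ Q := fun {Q h k} hf =>
    hf.1.1.subset (hf.2.2.2.1 ▸ hpF : p ∈ h ∩ k).1
  refine ⟨hfin.subset ?_, ?_⟩
  · rintro Q ⟨hQ, h', k', hf⟩
    exact ⟨hQ, hpQ hf⟩
  have hpP : p ∈ P := hpQ hb
  have hface : ∀ Q ∈ 𝒯, p ∈ Q →
      ((∀ y ∈ Q, minkowski n y ≤ c) ∨ ∀ y ∈ Q, c ≤ minkowski n y) →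
      ((∀ y ∈ Q, minkowski m y ≤ d) ∨ ∀ y ∈ Q, d ≤ minkowski m y) →
      IsFaceBetween Q {x ∈ Q | minkowski n x = c} {x ∈ Q | minkowski m x = d} F :=
    fun Q hQ hpQ => isFaceBetween_of_isLocalWedge h𝒯 hP hQ ⟨h, k, hb⟩ hn hm hnm hFe hpF hpQ
      (hloc P hP hpP) (hloc Q hQ hpQ)
  set L₁ : Set Spacetime → Prop := fun Q => ∀ y ∈ Q, minkowski n y ≤ c with hL₁
  set R₁ : Set Spacetime → Prop := fun Q => ∀ y ∈ Q, c ≤ minkowski n y with hR₁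
  set L₂ : Set Spacetime → Prop := fun Q => ∀ y ∈ Q, minkowski m y ≤ d with hL₂
  set R₂ : Set Spacetime → Prop := fun Q => ∀ y ∈ Q, d ≤ minkowski m y with hR₂
  have hPP : ∀ Q, Q ∈ 𝒯 ∧ IsPastPastFace Q F ↔ (Q ∈ 𝒯 ∧ p ∈ Q) ∧ L₁ Q ∧ L₂ Q := by
    intro Q
    constructor
    · rintro ⟨hQ, h', k', hf, hh, hk⟩
      refine ⟨⟨hQ, hpQ hf⟩, ?_⟩
      obtain ⟨-, -, hne', e, -⟩ := hf
      have i1 := past_of_subset_hyperface (h𝒯.polytope Q hQ).2 hne hn hm hnm hF hFc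
        (e ▸ Set.inter_subset_left) hh
      have i2 := past_of_subset_hyperface (h𝒯.polytope Q hQ).2 hne hn hm hnm hF hFc
        (e ▸ Set.inter_subset_right) hk
      rcases i1 with ⟨a1, b1⟩ | ⟨a1, b1⟩ <;> rcases i2 with ⟨a2, b2⟩ | ⟨a2, b2⟩
      exacts [absurd (b1.trans b2.symm) hne', ⟨a1, a2⟩, ⟨a2, a1⟩,
        absurd (b1.trans b2.symm) hne']
    · rintro ⟨⟨hQ, hp⟩, h1, h2⟩
      have hf := hface Q hQ hp (Or.inl h1) (Or.inl h2)
      exact ⟨hQ, _, _, hf, ⟨hf.1, n, c, hn, fun x hx => hx.2, h1⟩,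
        hf.2.1, m, d, hm, fun x hx => hx.2, h2⟩
  have hFF : ∀ Q, Q ∈ 𝒯 ∧ IsFutureFutureFace Q F ↔ (Q ∈ 𝒯 ∧ p ∈ Q) ∧ R₁ Q ∧ R₂ Q := by
    intro Q
    constructor
    · rintro ⟨hQ, h', k', hf, hh, hk⟩
      refine ⟨⟨hQ, hpQ hf⟩, ?_⟩
      obtain ⟨-, -, hne', e, -⟩ := hf
      have i1 := future_of_subset_hyperface (h𝒯.polytope Q hQ).2 hne hn hm hnm hF hFc
        (e ▸ Set.inter_subset_left) hh
      have i2 := future_of_subset_hyperface (h𝒯.polytope Q hQ).2 hne hn hm hnm hF hFc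
        (e ▸ Set.inter_subset_right) hk
      rcases i1 with ⟨a1, b1⟩ | ⟨a1, b1⟩ <;> rcases i2 with ⟨a2, b2⟩ | ⟨a2, b2⟩
      exacts [absurd (b1.trans b2.symm) hne', ⟨a1, a2⟩, ⟨a2, a1⟩,
        absurd (b1.trans b2.symm) hne']
    · rintro ⟨⟨hQ, hp⟩, h1, h2⟩
      have hf := hface Q hQ hp (Or.inr h1) (Or.inr h2)
      exact ⟨hQ, _, _, hf, ⟨hf.1, n, c, hn, fun x hx => hx.2, h1⟩,
        hf.2.1, m, d, hm, fun x hx => hx.2, h2⟩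
  have hPFu : ∀ Q, Q ∈ 𝒯 ∧ IsPastFutureFace Q F ↔
      (Q ∈ 𝒯 ∧ p ∈ Q) ∧ (L₁ Q ∧ R₂ Q ∨ R₁ Q ∧ L₂ Q) := by
    intro Q
    constructor
    · rintro ⟨hQ, h', k', hf, hh, hk⟩
      refine ⟨⟨hQ, hpQ hf⟩, ?_⟩
      obtain ⟨-, -, hne', e, -⟩ := hf
      have i1 := past_of_subset_hyperface (h𝒯.polytope Q hQ).2 hne hn hm hnm hF hFc
        (e ▸ Set.inter_subset_left) hh
      have i2 := future_of_subset_hyperface (h𝒯.polytope Q hQ).2 hne hn hm hnm hF hFc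
        (e ▸ Set.inter_subset_right) hk
      rcases i1 with ⟨a1, b1⟩ | ⟨a1, b1⟩ <;> rcases i2 with ⟨a2, b2⟩ | ⟨a2, b2⟩
      exacts [absurd (b1.trans b2.symm) hne', Or.inl ⟨a1, a2⟩, Or.inr ⟨a2, a1⟩,
        absurd (b1.trans b2.symm) hne']
    · rintro ⟨⟨hQ, hp⟩, ⟨h1, h2⟩ | ⟨h1, h2⟩⟩
      · have hf := hface Q hQ hp (Or.inl h1) (Or.inr h2)
        exact ⟨hQ, _, _, hf, ⟨hf.1, n, c, hn, fun x hx => hx.2, h1⟩,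
          hf.2.1, m, d, hm, fun x hx => hx.2, h2⟩
      · have hf := hface Q hQ hp (Or.inr h1) (Or.inl h2)
        refine ⟨hQ, _, _, ⟨hf.2.1, hf.1, hf.2.2.1.symm, ?_, hf.2.2.2.2⟩,
          ⟨hf.2.1, m, d, hm, fun x hx => hx.2, h2⟩, hf.1, n, c, hn, fun x hx => hx.2, h1⟩
        rw [Set.inter_comm]; exact hf.2.2.2.1
  -- The inner neighbourhood is needed to conclude that sample points near `p` are interior to their
  -- tiles.
  have hnear : ∀ᶠ x in 𝓝 p, ∀ᶠ y in 𝓝 x, (∀ Q ∈ 𝒯, y ∈ Q → p ∈ Q) ∧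
      ∀ Q ∈ {Q | Q ∈ 𝒯 ∧ p ∈ Q}, SameSide Q n c y → SameSide Q m d y → y ∈ Q := by
    refine Filter.Eventually.eventually_nhds ((eventually_mem_tile h𝒯 p).and ?_)
    rw [hfin.eventually_all]
    exact fun Q hQ => (hloc Q hQ.1 hQ.2).eventually_mem
  -- The four sign choices sample the four open quadrants: `σ` moves only `⟨m, ·⟩` and `τ` only `⟨n,
  -- ·⟩`, both with reversed sign since `⟨n, m⟩ < 0`.
  have hdir : ∀ σ τ : ℝ, ∀ᶠ t : ℝ in 𝓝[>] 0, ∀ᶠ y in 𝓝 (p + t • (σ • n + τ • m)),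
      (∀ Q ∈ 𝒯, y ∈ Q → p ∈ Q) ∧
      ∀ Q ∈ {Q | Q ∈ 𝒯 ∧ p ∈ Q}, SameSide Q n c y → SameSide Q m d y → y ∈ Q := by
    intro σ τ
    have hcont : Continuous fun t : ℝ => p + t • (σ • n + τ • m) := by fun_prop
    have ht := (hcont.tendsto' 0 p (by simp)).mono_left (nhdsWithin_le_nhds (s := Set.Ioi 0))
    exact ht.eventually hnear
  obtain ⟨t, ⟨⟨⟨⟨ht1, ht2⟩, ht3⟩, ht4⟩, ht⟩⟩ := (((((hdir 1 1).and (hdir (-1) (-1))).and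
    (hdir (-1) 1)).and (hdir 1 (-1))).and (self_mem_nhdsWithin : Set.Ioi (0 : ℝ) ∈ 𝓝[>] 0)).exists
  have ht : 0 < t := ht
  have hneg := mul_neg_of_pos_of_neg ht hnm
  set T := hfin.toFinset with hT
  have hmemT : ∀ Q, Q ∈ T ↔ Q ∈ 𝒯 ∧ p ∈ Q := fun Q => by rw [hT, Set.Finite.mem_toFinset]; rfl
  have hnd : ∀ (Q : Set Spacetime) (k : Spacetime) (e : ℝ), k ≠ 0 → Q ∈ 𝒯 →
      ¬ ((∀ y ∈ Q, minkowski k y ≤ e) ∧ ∀ y ∈ Q, e ≤ minkowski k y) := fun Q k e hk hQ hle =>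
    hk (eq_zero_of_interior (h𝒯.polytope Q hQ).2 fun x hx => le_antisymm (hle.1 x hx) (hle.2 x hx))
  -- Off the two hyperplanes, `x` is interior to each tile that contains it, and interiors of
  -- distinct tiles are disjoint.
  have hone : ∀ x : Spacetime, (∀ᶠ y in 𝓝 x, (∀ Q ∈ 𝒯, y ∈ Q → p ∈ Q) ∧
      ∀ Q ∈ {Q | Q ∈ 𝒯 ∧ p ∈ Q}, SameSide Q n c y → SameSide Q m d y → y ∈ Q) →
      minkowski n x ≠ c → minkowski m x ≠ d → (T.filter fun Q => x ∈ Q).card = 1 := by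
    intro x hx hxn hxm
    rw [Finset.card_eq_one]
    obtain ⟨Q, hQ, hxQ⟩ : x ∈ ⋃₀ 𝒯 := by rw [h𝒯.cover]; trivial
    have hint : ∀ Q ∈ 𝒯, x ∈ Q → x ∈ interior Q := fun Q hQ hxQ =>
      mem_interior_of_eventually (hx.mono fun y hy => hy.2 Q ⟨hQ, hx.self_of_nhds.1 Q hQ hxQ⟩)
        hxQ hxn hxm
    refine ⟨Q, ?_⟩
    ext Q'
    rw [Finset.mem_filter, hmemT, Finset.mem_singleton]
    constructor
    · rintro ⟨⟨hQ', -⟩, hxQ'⟩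
      by_contra hne
      exact Set.disjoint_left.1 (h𝒯.disjoint Q' hQ' Q hQ hne) (hint Q' hQ' hxQ') (hint Q hQ hxQ)
    · rintro rfl
      exact ⟨⟨hQ, hx.self_of_nhds.1 Q' hQ hxQ⟩, hxQ⟩
  have hvn : ∀ σ τ : ℝ, minkowski n (p + t • (σ • n + τ • m)) = c + τ * (t * minkowski n m) := by
    intro σ τ
    simp only [minkowski_add_right, minkowski_smul_right, hn.1, hpc.1]; ring
  have hvm : ∀ σ τ : ℝ, minkowski m (p + t • (σ • n + τ • m)) = d + σ * (t * minkowski n m) := by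
    intro σ τ
    simp only [minkowski_add_right, minkowski_smul_right, hm.1, hpc.2, minkowski_comm m n]; ring
  have hcnt : ∀ q r : Set Spacetime → Prop,
      (∀ Q, q Q ↔ (Q ∈ 𝒯 ∧ p ∈ Q) ∧ r Q) → {Q | q Q}.ncard = ∑ Q ∈ T, propIndicator (r Q) := by
    intro q r hq
    rw [sum_propIndicator, ← Set.ncard_coe_finset]
    congr 1
    ext Q
    simp [hq, hmemT]
  have hsum : ∀ (σ τ : ℝ) (p' : Set Spacetime → Prop), σ ≠ 0 → τ ≠ 0 →
      (∀ᶠ y in 𝓝 (p + t • (σ • n + τ • m)), (∀ Q ∈ 𝒯, y ∈ Q → p ∈ Q) ∧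
        ∀ Q ∈ {Q | Q ∈ 𝒯 ∧ p ∈ Q}, SameSide Q n c y → SameSide Q m d y → y ∈ Q) →
      (∀ Q, p' Q ↔ SameSide Q n c (p + t • (σ • n + τ • m)) ∧
        SameSide Q m d (p + t • (σ • n + τ • m))) →
      ∑ Q ∈ T, propIndicator (p' Q) = 1 := by
    intro σ τ p' hσ hτ hx hp'
    rw [sum_propIndicator, ← hone _ hx]
    · congr 1
      refine Finset.filter_congr fun Q hQ => ?_
      rw [hp']
      exact ⟨fun h => hx.self_of_nhds.2 Q ((hmemT Q).1 hQ) h.1 h.2,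
        fun h => ⟨sameSide_of_mem h, sameSide_of_mem h⟩⟩
    · rw [hvn]; simpa using ⟨hτ, ht.ne', hnm.ne⟩
    · rw [hvm]; simpa using ⟨hσ, ht.ne', hnm.ne⟩
  have s1 := hsum 1 1 (fun Q => ¬ R₁ Q ∧ ¬ R₂ Q) one_ne_zero one_ne_zero ht1 fun Q => by
    have : ¬ c ≤ c + 1 * (t * minkowski n m) := by linarith
    have : ¬ d ≤ d + 1 * (t * minkowski n m) := by linarith
    have : c + 1 * (t * minkowski n m) ≤ c := by linarith
    have : d + 1 * (t * minkowski n m) ≤ d := by linarith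
    simp only [SameSide, hvn, hvm]
    tauto
  have s2 := hsum (-1) (-1) (fun Q => ¬ L₁ Q ∧ ¬ L₂ Q) (by simp) (by simp) ht2 fun Q => by
    have : c ≤ c + (-1) * (t * minkowski n m) := by linarith
    have : d ≤ d + (-1) * (t * minkowski n m) := by linarith
    have : ¬ c + (-1) * (t * minkowski n m) ≤ c := by linarith
    have : ¬ d + (-1) * (t * minkowski n m) ≤ d := by linarith
    simp only [SameSide, hvn, hvm]
    tauto
  have s3 := hsum (-1) 1 (fun Q => ¬ R₁ Q ∧ ¬ L₂ Q) (by simp) (by simp) ht3 fun Q => by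
    have : ¬ c ≤ c + 1 * (t * minkowski n m) := by linarith
    have : d ≤ d + (-1) * (t * minkowski n m) := by linarith
    have : c + 1 * (t * minkowski n m) ≤ c := by linarith
    have : ¬ d + (-1) * (t * minkowski n m) ≤ d := by linarith
    simp only [SameSide, hvn, hvm]
    tauto
  have s4 := hsum 1 (-1) (fun Q => ¬ L₁ Q ∧ ¬ R₂ Q) (by simp) (by simp) ht4 fun Q => by
    have : c ≤ c + (-1) * (t * minkowski n m) := by linarith
    have : ¬ d ≤ d + 1 * (t * minkowski n m) := by linarith
    have : ¬ c + (-1) * (t * minkowski n m) ≤ c := by linarith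
    have : d + 1 * (t * minkowski n m) ≤ d := by linarith
    simp only [SameSide, hvn, hvm]
    tauto
  rw [hcnt _ _ hPP, hcnt _ _ hFF, hcnt _ _ hPFu]
  -- Summed over the tiles at `p`, the quadrant terms equal 1 each and cancel in pairs.
  have hall := Finset.sum_congr (rfl : T = T) fun Q hQ =>
    quadrant_count (L₁ := L₁ Q) (R₁ := R₁ Q) (L₂ := L₂ Q) (R₂ := R₂ Q)
      (hnd Q n c hn.ne_zero ((hmemT Q).1 hQ).1) (hnd Q m d hm.ne_zero ((hmemT Q).1 hQ).1)
  simp only [Finset.sum_add_distrib] at hall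
  omega

/-! ### Summing the balance around a vertex -/

lemma IsConvexPolytope.finite_hyperfaces {P : Set Spacetime} (hP : IsConvexPolytope P) :
    {h | IsHyperface P h}.Finite := by
  obtain ⟨A, hA, hr, hface⟩ := hP.exists_halfSpaces
  have := hA.to_subtype
  refine (Set.finite_range fun g : A => {x ∈ P | minkowski g.1.1 x = g.1.2}).subset fun h hh => ?_
  obtain ⟨g, rfl⟩ := IsHyperface.exists_eq_inter hP.2 hP.convex (fun g : A => g.1.1)
    (fun g : A => g.1.2) (fun g => (hface g g.2).1) (by simpa using hr) hh
  exact ⟨g, rfl⟩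

lemma IsConvexPolytope.finite_twoFaces {P : Set Spacetime} (hP : IsConvexPolytope P) :
    {F | IsTwoFace P F}.Finite := by
  refine ((hP.finite_hyperfaces.prod hP.finite_hyperfaces).image fun q => q.1 ∩ q.2).subset ?_
  rintro F ⟨h, k, hh, hk, -, rfl, -⟩
  exact ⟨(h, k), ⟨hh, hk⟩, rfl⟩

lemma IsTwoFace.isExtreme {P F : Set Spacetime} (hF : IsTwoFace P F) : IsExtreme ℝ P F := by
  obtain ⟨h, k, hh, hk, -, rfl, -⟩ := hF
  exact hh.1.isExtreme.inter hk.1.isExtreme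

lemma IsPastPastFace.isTwoFace {P F : Set Spacetime} (h : IsPastPastFace P F) : IsTwoFace P F :=
  let ⟨h, k, hb, _⟩ := h; ⟨h, k, hb⟩

lemma IsPastFutureFace.isTwoFace {P F : Set Spacetime} (h : IsPastFutureFace P F) :
    IsTwoFace P F := let ⟨h, k, hb, _⟩ := h; ⟨h, k, hb⟩

lemma IsFutureFutureFace.isTwoFace {P F : Set Spacetime} (h : IsFutureFutureFace P F) :
    IsTwoFace P F := let ⟨h, k, hb, _⟩ := h; ⟨h, k, hb⟩

lemma finite_tiles_at_vertex {𝒯 : Set (Set Spacetime)} (h𝒯 : IsTessellation 𝒯) (v : Spacetime) :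
    {Q | Q ∈ 𝒯 ∧ v ∈ Q.extremePoints ℝ}.Finite :=
  (sep_finite_of_isTessellation h𝒯 v).subset fun _ hQ => ⟨hQ.1, hQ.2.1⟩

/-- The balance at 2d faces, summed over the 2d faces that have the vertex `v`. -/
theorem vertex_balance {𝒯 : Set (Set Spacetime)} (h𝒯 : IsTessellation 𝒯)
    (hnull : ∀ P ∈ 𝒯, IsNullFaced P) (v : Spacetime) :
    ∑ Q ∈ (finite_tiles_at_vertex h𝒯 v).toFinset, {F | IsPastFutureFace Q F ∧ v ∈ F}.ncard =
      ∑ Q ∈ (finite_tiles_at_vertex h𝒯 v).toFinset, ({F | IsPastPastFace Q F ∧ v ∈ F}.ncard +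
        {F | IsFutureFutureFace Q F ∧ v ∈ F}.ncard) := by
  classical
  set T := (finite_tiles_at_vertex h𝒯 v).toFinset with hT
  have hmemT : ∀ Q, Q ∈ T ↔ Q ∈ 𝒯 ∧ v ∈ Q.extremePoints ℝ := fun Q => by
    rw [hT, Set.Finite.mem_toFinset]; rfl
  have hfin : (⋃ Q ∈ T, {F | IsTwoFace Q F ∧ v ∈ F}).Finite :=
    T.finite_toSet.biUnion fun Q hQ =>
      (h𝒯.polytope Q ((hmemT Q).1 hQ).1).finite_twoFaces.subset fun F hF => hF.1
  set 𝓕 := hfin.toFinset with h𝓕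
  have hmem𝓕 : ∀ F, F ∈ 𝓕 ↔ ∃ Q ∈ T, IsTwoFace Q F ∧ v ∈ F := fun F => by
    rw [h𝓕, Set.Finite.mem_toFinset]; simp only [Set.mem_iUnion, exists_prop, Set.mem_ofPred_eq]
  -- Double counting of the incident pairs of a tile and a 2d face through `v`.
  have key : ∀ r : Set Spacetime → Set Spacetime → Prop, (∀ Q F, r Q F → IsTwoFace Q F) →
      ∑ Q ∈ T, {F | r Q F ∧ v ∈ F}.ncard = ∑ F ∈ 𝓕, {Q | Q ∈ 𝒯 ∧ r Q F}.ncard := by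
    intro r hr
    have h1 : ∀ Q ∈ T, {F | r Q F ∧ v ∈ F}.ncard = ∑ F ∈ 𝓕, propIndicator (r Q F) := by
      intro Q hQ
      rw [sum_propIndicator, ← Set.ncard_coe_finset]
      congr 1
      ext F
      simp only [Set.mem_ofPred_eq, Finset.coe_filter, hmem𝓕]
      exact ⟨fun h => ⟨⟨Q, hQ, hr Q F h.1, h.2⟩, h.1⟩, fun ⟨⟨_, _, _, h⟩, h'⟩ => ⟨h', h⟩⟩
    have h2 : ∀ F ∈ 𝓕, {Q | Q ∈ 𝒯 ∧ r Q F}.ncard = ∑ Q ∈ T, propIndicator (r Q F) := by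
      intro F hF
      rw [sum_propIndicator, ← Set.ncard_coe_finset]
      congr 1
      ext Q
      simp only [Set.mem_ofPred_eq, Finset.coe_filter, hmemT]
      refine ⟨fun h => ⟨⟨h.1, ?_⟩, h.2⟩, fun h => ⟨h.1.1, h.2⟩⟩
      -- `v` is a vertex of `Q'`, hence of its face `F`, hence of every tile that has `F` as a face.
      obtain ⟨Q', hQ', hF', hv⟩ := (hmem𝓕 F).1 hF
      refine (hr Q F h.2).isExtreme.extremePoints_subset_extremePoints ?_
      rw [hF'.isExtreme.extremePoints_eq]
      exact ⟨hv, ((hmemT Q').1 hQ').2⟩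
    rw [Finset.sum_congr rfl h1, Finset.sum_congr rfl h2, Finset.sum_comm]
  rw [Finset.sum_add_distrib, key _ fun _ _ h => h.isTwoFace, key _ fun _ _ h => h.isTwoFace,
    key _ fun _ _ h => h.isTwoFace, ← Finset.sum_add_distrib]
  refine Finset.sum_congr rfl fun F hF => ?_
  obtain ⟨Q, hQ, hF', -⟩ := (hmem𝓕 F).1 hF
  exact (balance_of_isTessellation h𝒯 hnull ((hmemT Q).1 hQ).1 hF').2

/-! ### Faces of a 4-simplex in barycentric coordinates -/

/-- The sign is chosen so that `0 ≤ f x` reads `⟨a, x⟩ ≤ r`. -/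
lemma exists_minkowski_affine (f : Spacetime →ᵃ[ℝ] ℝ) : ∃ a r, ∀ x, f x = r - minkowski a x := by
  obtain ⟨a, ha⟩ := exists_eq_minkowski (-f.linear)
  refine ⟨a, f 0, fun x => ?_⟩
  have h1 := ha x
  have h2 := f.map_vadd 0 x
  simp only [vadd_eq_add, add_zero, LinearMap.neg_apply] at h1 h2
  rw [h2, ← h1]; ring

lemma affineSpan_range_eq_top {v : Fin 5 → Spacetime} (hv : AffineIndependent ℝ v) :
    affineSpan ℝ (Set.range v) = ⊤ := by
  rw [hv.affineSpan_eq_top_iff_card_eq_finrank_add_one]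
  simp

lemma isConvexPolytope_of_affineBasis (b : AffineBasis (Fin 5) ℝ Spacetime) :
    IsConvexPolytope (convexHull ℝ (Set.range b)) :=
  ⟨⟨Set.range b, Set.finite_range b, rfl⟩,
    interior_convexHull_nonempty_iff_affineSpan_eq_top.2 b.tot⟩

/-- The face of a simplex on which the barycentric coordinates in `A` vanish. -/
def simplexFace (b : AffineBasis (Fin 5) ℝ Spacetime) (A : Finset (Fin 5)) : Set Spacetime :=
  {x ∈ convexHull ℝ (Set.range b) | ∀ i ∈ A, b.coord i x = 0}

section Simplex

variable (b : AffineBasis (Fin 5) ℝ Spacetime)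

lemma vertex_mem_simplexFace (A : Finset (Fin 5)) (j : Fin 5) :
    b j ∈ simplexFace b A ↔ j ∉ A := by
  refine ⟨fun h hj => ?_, fun h => ⟨subset_convexHull ℝ _ ⟨j, rfl⟩, fun i hi => ?_⟩⟩
  · simpa using h.2 j hj
  · exact b.coord_apply_ne (by rintro rfl; exact h hi)

lemma simplexFace_injective : Function.Injective (simplexFace b) := fun A B h => by
  ext j
  rw [← not_iff_not, ← vertex_mem_simplexFace b A, ← vertex_mem_simplexFace b B, h]

lemma simplexFace_inter (A B : Finset (Fin 5)) :
    simplexFace b A ∩ simplexFace b B = simplexFace b (A ∪ B) := by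
  ext x
  simp only [simplexFace, Set.mem_inter_iff, Set.mem_ofPred_eq, Finset.mem_union]
  refine ⟨fun ⟨⟨h, h1⟩, _, h2⟩ => ⟨h, fun i hi => hi.elim (h1 i) (h2 i)⟩,
    fun ⟨h, h1⟩ => ⟨⟨h, fun i hi => h1 i (Or.inl hi)⟩, h, fun i hi => h1 i (Or.inr hi)⟩⟩

lemma simplexFace_eq_convexHull (A : Finset (Fin 5)) :
    simplexFace b A = convexHull ℝ ((Aᶜ.image b : Finset Spacetime) : Set Spacetime) := by
  refine Set.Subset.antisymm ?_ ?_
  · rintro x ⟨hx, hA⟩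
    rw [b.convexHull_eq_nonneg_coord] at hx
    have hz : ∀ i ∈ Finset.univ, i ∉ Aᶜ → b.coord i x = 0 := fun i _ hi => hA i (by simpa using hi)
    have hs : x = ∑ i ∈ Aᶜ, b.coord i x • b i := by
      rw [Finset.sum_subset (Finset.subset_univ _) fun i hi hi' => by rw [hz i hi hi', zero_smul],
        b.linear_combination_coord_eq_self]
    rw [hs]
    refine (convex_convexHull ℝ _).sum_mem (fun i _ => hx i) ?_ fun i hi => ?_
    · rw [Finset.sum_subset (Finset.subset_univ _) hz, b.sum_coord_apply_eq_one]
    · exact subset_convexHull ℝ _ (by simpa using ⟨i, by simpa using hi, rfl⟩)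
  · refine fun x hx => ⟨convexHull_mono (by simp) hx, fun i hi => ?_⟩
    have hc : Convex ℝ {y | b.coord i y = 0} := by
      have : {y | b.coord i y = 0} = b.coord i ⁻¹' {0} := rfl
      rw [this]
      exact (convex_singleton 0).affine_preimage _
    refine convexHull_min ?_ hc hx
    rintro _ hy
    obtain ⟨j, hj, rfl⟩ := Finset.mem_image.1 hy
    exact b.coord_apply_ne (by rintro rfl; exact Finset.mem_compl.1 hj hi)

lemma affDim_simplexFace {A : Finset (Fin 5)} {d : ℕ} (hA : A.card + d = 4) :
    affDim (simplexFace b A) = d := by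
  rw [affDim, simplexFace_eq_convexHull, ← direction_affineSpan, affineSpan_convexHull,
    direction_affineSpan]
  refine b.ind.finrank_vectorSpan_image_finset ?_
  rw [Finset.card_compl, Fintype.card_fin]; omega

lemma isHyperface_simplex_iff (h : Set Spacetime) :
    IsHyperface (convexHull ℝ (Set.range b)) h ↔ ∃ i, h = simplexFace b {i} := by
  choose a r har using fun i => exists_minkowski_affine (b.coord i)
  have hmem : ∀ x, x ∈ convexHull ℝ (Set.range b) ↔ ∀ i, minkowski (a i) x ≤ r i := by
    intro x
    rw [b.convexHull_eq_nonneg_coord]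
    simp [har]
  have heq : ∀ i, simplexFace b {i} =
      {x ∈ convexHull ℝ (Set.range b) | minkowski (a i) x = r i} := by
    intro i
    ext x
    simp [simplexFace, har, sub_eq_zero, eq_comm]
  have hP := isConvexPolytope_of_affineBasis b
  constructor
  · intro hh
    have ha : ∀ i, a i ≠ 0 := by
      intro i e
      have h1 := har i (b i)
      obtain ⟨j, hj⟩ := exists_ne i
      have h2 := har i (b j)
      rw [e, minkowski_zero_left] at h1 h2
      rw [b.coord_apply_eq] at h1
      rw [b.coord_apply_ne hj.symm] at h2
      linarith
    obtain ⟨i, hi⟩ := hh.exists_eq_inter hP.2 hP.convex a r ha hmem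
    exact ⟨i, by rw [heq, hi]⟩
  · rintro ⟨i, rfl⟩
    refine ⟨?_, affDim_simplexFace b (by simp)⟩
    rw [heq]
    exact isExposed_of_le fun x hx => (hmem x).1 hx i

lemma isFaceBetween_simplex_iff (h k F : Set Spacetime) :
    IsFaceBetween (convexHull ℝ (Set.range b)) h k F ↔
      ∃ i j, i ≠ j ∧ h = simplexFace b {i} ∧ k = simplexFace b {j} ∧ F = simplexFace b {i, j} := by
  constructor
  · rintro ⟨hh, hk, hne, rfl, -⟩
    obtain ⟨i, rfl⟩ := (isHyperface_simplex_iff b h).1 hh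
    obtain ⟨j, rfl⟩ := (isHyperface_simplex_iff b k).1 hk
    exact ⟨i, j, fun e => hne (by rw [e]), rfl, rfl, by rw [simplexFace_inter]; rfl⟩
  · rintro ⟨i, j, hij, rfl, rfl, rfl⟩
    refine ⟨(isHyperface_simplex_iff b _).2 ⟨i, rfl⟩, (isHyperface_simplex_iff b _).2 ⟨j, rfl⟩,
      fun e => hij ?_, by rw [simplexFace_inter]; rfl, affDim_simplexFace b ?_⟩
    · simpa using simplexFace_injective b e
    · rw [Finset.card_pair hij]

/-- The vertex is the only point of the simplex where the `j`-th barycentric coordinate reaches its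
maximum 1, so it is exposed. -/
lemma vertex_mem_extremePoints (j : Fin 5) :
    b j ∈ (convexHull ℝ (Set.range b)).extremePoints ℝ := by
  obtain ⟨a, r, har⟩ := exists_minkowski_affine (b.coord j)
  have hb : ∀ x ∈ convexHull ℝ (Set.range b), ∀ i, 0 ≤ b.coord i x := fun x hx => by
    rwa [b.convexHull_eq_nonneg_coord] at hx
  have h1 : ∀ x ∈ convexHull ℝ (Set.range b), minkowski (-a) x ≤ 1 - r := by
    intro x hx
    have := Finset.single_le_sum (fun i _ => hb x hx i) (Finset.mem_univ j)
    rw [b.sum_coord_apply_eq_one, har] at this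
    rw [minkowski_comm, minkowski_neg_right, minkowski_comm]
    linarith
  have h2 : {x ∈ convexHull ℝ (Set.range b) | minkowski (-a) x = 1 - r} = {b j} := by
    ext x
    constructor
    · rintro ⟨hx, e⟩
      rw [minkowski_comm, minkowski_neg_right, minkowski_comm] at e
      have hj : b.coord j x = 1 := by rw [har]; linarith
      have hsum := b.sum_coord_apply_eq_one x
      rw [← Finset.add_sum_erase _ _ (Finset.mem_univ j), hj, add_eq_left,
        Finset.sum_eq_zero_iff_of_nonneg fun i _ => hb x hx i] at hsum
      rw [Set.mem_singleton_iff, ← b.linear_combination_coord_eq_self x,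
        Finset.sum_eq_single j (fun i hi hij => by rw [hsum i (by simpa using hij), zero_smul])
          (by simp), hj, one_smul]
    · rintro rfl
      refine ⟨subset_convexHull ℝ _ ⟨j, rfl⟩, ?_⟩
      have := har (b j)
      rw [b.coord_apply_eq] at this
      rw [minkowski_comm, minkowski_neg_right, minkowski_comm]
      linarith
  have h3 := (isExposed_of_le h1).isExtreme
  rw [h2, isExtreme_singleton] at h3
  exact h3

open Classical in
/-- The indices of the past hyperfaces of a simplex. -/
noncomputable def pastIndices : Finset (Fin 5) :=
  Finset.univ.filter fun i =>
    IsPastHyperface (convexHull ℝ (Set.range b)) (simplexFace b {i})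

lemma mem_pastIndices (i : Fin 5) : i ∈ pastIndices b ↔
    IsPastHyperface (convexHull ℝ (Set.range b)) (simplexFace b {i}) := by
  simp [pastIndices]

lemma isPastHyperface_simplex_iff (h : Set Spacetime) :
    IsPastHyperface (convexHull ℝ (Set.range b)) h ↔
      ∃ i ∈ pastIndices b, h = simplexFace b {i} := by
  constructor
  · intro hh
    obtain ⟨i, rfl⟩ := (isHyperface_simplex_iff b h).1 hh.1
    exact ⟨i, (mem_pastIndices b i).2 hh, rfl⟩
  · rintro ⟨i, hi, rfl⟩
    exact (mem_pastIndices b i).1 hi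

end Simplex

/-! ### Past and future hyperfaces of a null-faced simplex -/

section NullFacedSimplex

variable {b : AffineBasis (Fin 5) ℝ Spacetime}

lemma notMem_pastIndices (hb : IsNullFaced (convexHull ℝ (Set.range b))) (i : Fin 5) :
    i ∉ pastIndices b ↔
      IsFutureHyperface (convexHull ℝ (Set.range b)) (simplexFace b {i}) := by
  have hh := (isHyperface_simplex_iff b (simplexFace b {i})).2 ⟨i, rfl⟩
  have := hh.xor_past_future (isConvexPolytope_of_affineBasis b).2 (hb _ hh)
  rw [mem_pastIndices]
  exact xor_iff_not_iff'.1 this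

lemma isFutureHyperface_simplex_iff (hb : IsNullFaced (convexHull ℝ (Set.range b)))
    (h : Set Spacetime) : IsFutureHyperface (convexHull ℝ (Set.range b)) h ↔
      ∃ i ∈ (pastIndices b)ᶜ, h = simplexFace b {i} := by
  constructor
  · intro hh
    obtain ⟨i, rfl⟩ := (isHyperface_simplex_iff b h).1 hh.1
    exact ⟨i, Finset.mem_compl.2 ((notMem_pastIndices hb i).2 hh), rfl⟩
  · rintro ⟨i, hi, rfl⟩
    exact (notMem_pastIndices hb i).1 (Finset.mem_compl.1 hi)

/-- Any four hyperfaces of a null-faced simplex include a past one and a future one. -/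
lemma exists_past_and_future_ne (hb : IsNullFaced (convexHull ℝ (Set.range b))) (j : Fin 5) :
    (∃ i, i ≠ j ∧ i ∈ pastIndices b) ∧ ∃ i, i ≠ j ∧ i ∉ pastIndices b := by
  set P := convexHull ℝ (Set.range b) with hPdef
  have hP : IsConvexPolytope P := isConvexPolytope_of_affineBasis b
  have hyp : ∀ i, IsHyperface P (simplexFace b {i}) := fun i =>
    (isHyperface_simplex_iff b _).2 ⟨i, rfl⟩
  choose n c hn hc using fun i => hb _ (hyp i)
  choose a r har using fun i => exists_minkowski_affine (b.coord i)
  have hκ : ∀ i, ∃ κ : ℝ, a i = κ • n i ∧ r i = κ * c i ∧ κ ≠ 0 := by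
    intro i
    have ha : a i ≠ 0 := by
      intro e
      have h1 := har i (b i)
      have h2 := har i (b (i + 1))
      rw [e, minkowski_zero_left] at h1 h2
      rw [b.coord_apply_eq] at h1
      rw [b.coord_apply_ne (by simp)] at h2
      linarith
    have hr : ∀ x ∈ simplexFace b {i}, minkowski (a i) x = r i := by
      intro x hx
      have := har i x
      rw [hx.2 i (by simp)] at this
      linarith
    obtain ⟨κ, h0, h1, h2⟩ := hyperplane_unique (hyp i).2 ha (hn i).ne_zero hr (hc i)
    exact ⟨κ, h1, h2, h0⟩
  choose κ ha hr hκ0 using hκ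
  have hside : ∀ i, ∀ x ∈ P, κ i * minkowski (n i) x ≤ κ i * c i := by
    intro i x hx
    rw [hPdef, b.convexHull_eq_nonneg_coord] at hx
    have := hx i
    rw [har, ha, hr, minkowski_smul_left] at this
    linarith
  have hpos : ∀ i, i ∈ pastIndices b → 0 < κ i := by
    intro i hi
    by_contra hneg
    have hneg : κ i < 0 := lt_of_le_of_ne (not_lt.1 hneg) (hκ0 i)
    exact not_past_and_future hP.2 ((mem_pastIndices b i).1 hi)
      ⟨hyp i, n i, c i, hn i, hc i, fun x hx => (mul_le_mul_left_of_neg hneg).1 (hside i x hx)⟩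
  have hneg : ∀ i, i ∉ pastIndices b → κ i < 0 := by
    intro i hi
    by_contra hpos
    have hpos : 0 < κ i := lt_of_le_of_ne (not_lt.1 hpos) (hκ0 i).symm
    exact hi ((mem_pastIndices b i).2
      ⟨hyp i, n i, c i, hn i, hc i, fun x hx => le_of_mul_le_mul_left (hside i x hx) hpos⟩)
  have hlt : ∀ i, i ≠ j → minkowski (n i) (n j) < 0 := fun i hij =>
    (((isFaceBetween_simplex_iff b _ _ _).2 ⟨i, j, hij, rfl, rfl, rfl⟩).eq_inter hP.2 (hn i) (hn j)
      (hc i) (hc j)).1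
  -- The barycentric coordinates sum to 1 both at the point `n j` and at the origin; subtracting
  -- leaves their linear parts, and the `j`-th term vanishes because `n j` is null.
  have hsum : ∑ i ∈ Finset.univ.erase j, κ i * minkowski (n i) (n j) = 0 := by
    have h1 := b.sum_coord_apply_eq_one (n j)
    have h2 := b.sum_coord_apply_eq_one 0
    simp only [har, Finset.sum_sub_distrib, ha, minkowski_smul_left] at h1 h2
    have h3 : ∀ i, minkowski (n i) 0 = 0 := fun i => by simp [minkowski]
    simp only [h3, mul_zero, Finset.sum_const_zero] at h2
    rw [← Finset.add_sum_erase _ (fun i => κ i * minkowski (n i) (n j)) (Finset.mem_univ j),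
      (hn j).1] at h1
    linarith
  have hne : (Finset.univ.erase j).Nonempty := by
    obtain ⟨i, hi⟩ := exists_ne j
    exact ⟨i, by simpa using hi⟩
  constructor
  · by_contra! h
    have := Finset.sum_pos (fun i hi => mul_pos_of_neg_of_neg
      (hneg i (h i (Finset.ne_of_mem_erase hi))) (hlt i (Finset.ne_of_mem_erase hi))) hne
    linarith
  · by_contra! h
    have := Finset.sum_neg (fun i hi => mul_neg_of_pos_of_neg
      (hpos i (h i (Finset.ne_of_mem_erase hi))) (hlt i (Finset.ne_of_mem_erase hi))) hne
    linarith

/-- Leaving out a known past index still leaves a past one, so there are at least two; likewise for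
future indices, and there are five in all. -/
lemma card_pastIndices (hb : IsNullFaced (convexHull ℝ (Set.range b))) :
    (pastIndices b).card = 2 ∨ (pastIndices b).card = 3 := by
  have h1 : 1 < (pastIndices b).card := by
    obtain ⟨i, -, hi⟩ := (exists_past_and_future_ne hb 0).1
    obtain ⟨k, hk, hk'⟩ := (exists_past_and_future_ne hb i).1
    exact Finset.one_lt_card.2 ⟨k, hk', i, hi, hk⟩
  have h2 : 1 < (pastIndices b)ᶜ.card := by
    obtain ⟨i, -, hi⟩ := (exists_past_and_future_ne hb 0).2
    obtain ⟨k, hk, hk'⟩ := (exists_past_and_future_ne hb i).2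
    exact Finset.one_lt_card.2 ⟨k, by simpa using hk', i, by simpa using hi, hk⟩
  rw [Finset.card_compl, Fintype.card_fin] at h2
  omega

lemma isPastPastFace_simplex_iff (F : Set Spacetime) :
    IsPastPastFace (convexHull ℝ (Set.range b)) F ↔
      ∃ A, A ∈ (pastIndices b).powersetCard 2 ∧ F = simplexFace b A := by
  constructor
  · rintro ⟨h, k, hf, hh, hk⟩
    obtain ⟨i, j, hij, rfl, rfl, rfl⟩ := (isFaceBetween_simplex_iff b _ _ _).1 hf
    refine ⟨{i, j}, ?_, rfl⟩
    rw [Finset.mem_powersetCard, Finset.card_pair hij, Finset.insert_subset_iff,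
      Finset.singleton_subset_iff]
    exact ⟨⟨(mem_pastIndices b i).2 hh, (mem_pastIndices b j).2 hk⟩, rfl⟩
  · rintro ⟨A, hA, rfl⟩
    rw [Finset.mem_powersetCard, Finset.card_eq_two] at hA
    obtain ⟨hA, i, j, hij, rfl⟩ := hA
    rw [Finset.insert_subset_iff, Finset.singleton_subset_iff] at hA
    exact ⟨_, _, (isFaceBetween_simplex_iff b _ _ _).2 ⟨i, j, hij, rfl, rfl, rfl⟩,
      (mem_pastIndices b i).1 hA.1, (mem_pastIndices b j).1 hA.2⟩

lemma isFutureFutureFace_simplex_iff (hb : IsNullFaced (convexHull ℝ (Set.range b)))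
    (F : Set Spacetime) :
    IsFutureFutureFace (convexHull ℝ (Set.range b)) F ↔
      ∃ A, A ∈ (pastIndices b)ᶜ.powersetCard 2 ∧ F = simplexFace b A := by
  constructor
  · rintro ⟨h, k, hf, hh, hk⟩
    obtain ⟨i, j, hij, rfl, rfl, rfl⟩ := (isFaceBetween_simplex_iff b _ _ _).1 hf
    refine ⟨{i, j}, ?_, rfl⟩
    rw [Finset.mem_powersetCard, Finset.card_pair hij, Finset.insert_subset_iff,
      Finset.singleton_subset_iff, Finset.mem_compl, Finset.mem_compl]
    exact ⟨⟨(notMem_pastIndices hb i).2 hh, (notMem_pastIndices hb j).2 hk⟩, rfl⟩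
  · rintro ⟨A, hA, rfl⟩
    rw [Finset.mem_powersetCard, Finset.card_eq_two] at hA
    obtain ⟨hA, i, j, hij, rfl⟩ := hA
    rw [Finset.insert_subset_iff, Finset.singleton_subset_iff, Finset.mem_compl,
      Finset.mem_compl] at hA
    exact ⟨_, _, (isFaceBetween_simplex_iff b _ _ _).2 ⟨i, j, hij, rfl, rfl, rfl⟩,
      (notMem_pastIndices hb i).1 hA.1, (notMem_pastIndices hb j).1 hA.2⟩

/-- The two-element sets with one element in `S` and one outside of `S`. -/
def mixedPairs (S : Finset (Fin 5)) : Finset (Finset (Fin 5)) :=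
  (Finset.univ.powersetCard 2).filter fun A => ¬ A ⊆ S ∧ ¬ A ⊆ Sᶜ

lemma isPastFutureFace_simplex_iff (hb : IsNullFaced (convexHull ℝ (Set.range b)))
    (F : Set Spacetime) :
    IsPastFutureFace (convexHull ℝ (Set.range b)) F ↔
      ∃ A, A ∈ mixedPairs (pastIndices b) ∧ F = simplexFace b A := by
  simp only [mixedPairs, Finset.mem_filter, Finset.mem_powersetCard, Finset.subset_univ, true_and]
  constructor
  · rintro ⟨h, k, hf, hh, hk⟩
    obtain ⟨i, j, hij, rfl, rfl, rfl⟩ := (isFaceBetween_simplex_iff b _ _ _).1 hf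
    refine ⟨{i, j}, ⟨Finset.card_pair hij, fun h => ?_, fun h => ?_⟩, rfl⟩
    · exact (notMem_pastIndices hb j).2 hk (h (by simp))
    · exact Finset.mem_compl.1 (h (by simp : i ∈ {i, j})) ((mem_pastIndices b i).2 hh)
  · rintro ⟨A, ⟨hA, h1, h2⟩, rfl⟩
    rw [Finset.card_eq_two] at hA
    obtain ⟨i, j, hij, rfl⟩ := hA
    simp only [Finset.insert_subset_iff, Finset.singleton_subset_iff, Finset.mem_compl] at h1 h2
    by_cases hi : i ∈ pastIndices b
    · have hj : j ∉ pastIndices b := fun hj => h1 ⟨hi, hj⟩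
      exact ⟨_, _, (isFaceBetween_simplex_iff b _ _ _).2 ⟨i, j, hij, rfl, rfl, rfl⟩,
        (mem_pastIndices b i).1 hi, (notMem_pastIndices hb j).1 hj⟩
    · have hj : j ∈ pastIndices b := by_contra fun hj => h2 ⟨hi, hj⟩
      exact ⟨_, _, (isFaceBetween_simplex_iff b _ _ _).2 ⟨j, i, hij.symm, rfl, rfl,
        by rw [Finset.pair_comm]⟩, (mem_pastIndices b j).1 hj, (notMem_pastIndices hb i).1 hi⟩

lemma isTwoFace_simplex_iff (F : Set Spacetime) :
    IsTwoFace (convexHull ℝ (Set.range b)) F ↔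
      ∃ A, A ∈ Finset.univ.powersetCard 2 ∧ F = simplexFace b A := by
  simp only [Finset.mem_powersetCard, Finset.subset_univ, true_and]
  constructor
  · rintro ⟨h, k, hf⟩
    obtain ⟨i, j, hij, -, -, rfl⟩ := (isFaceBetween_simplex_iff b _ _ _).1 hf
    exact ⟨{i, j}, Finset.card_pair hij, rfl⟩
  · rintro ⟨A, hA, rfl⟩
    obtain ⟨i, j, hij, rfl⟩ := Finset.card_eq_two.1 hA
    exact ⟨_, _, (isFaceBetween_simplex_iff b _ _ _).2 ⟨i, j, hij, rfl, rfl, rfl⟩⟩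

lemma ncard_simplexFaces {q : Set Spacetime → Prop} {𝒜 : Finset (Finset (Fin 5))}
    (hq : ∀ F, q F ↔ ∃ A, A ∈ 𝒜 ∧ F = simplexFace b A) : {F | q F}.ncard = 𝒜.card := by
  rw [← Set.ncard_coe_finset 𝒜, ← Set.ncard_image_of_injective _ (simplexFace_injective b)]
  congr 1
  ext F
  simp [hq, eq_comm]

lemma ncard_simplexFaces_vertex {q : Set Spacetime → Prop} {𝒜 : Finset (Finset (Fin 5))}
    (hq : ∀ F, q F ↔ ∃ A, A ∈ 𝒜 ∧ F = simplexFace b A) (j : Fin 5) :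
    {F | q F ∧ b j ∈ F}.ncard = (𝒜.filter fun A => j ∉ A).card := by
  refine ncard_simplexFaces (b := b) fun F => ?_
  rw [hq]
  constructor
  · rintro ⟨⟨A, hA, rfl⟩, h⟩
    exact ⟨A, Finset.mem_filter.2 ⟨hA, (vertex_mem_simplexFace b A j).1 h⟩, rfl⟩
  · rintro ⟨A, hA, rfl⟩
    rw [Finset.mem_filter] at hA
    exact ⟨⟨A, hA.1, rfl⟩, (vertex_mem_simplexFace b A j).2 hA.2⟩

/-- A pair lies in `S`, in `Sᶜ`, or meets both. The predicate `q` serves to count either all 2d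
faces or only those at a given vertex. -/
lemma card_filter_mixedPairs (S : Finset (Fin 5)) (q : Finset (Fin 5) → Prop) [DecidablePred q] :
    ((mixedPairs S).filter q).card + ((S.powersetCard 2).filter q).card +
      ((Sᶜ.powersetCard 2).filter q).card = ((Finset.univ.powersetCard 2).filter q).card := by
  rw [← Finset.card_union_of_disjoint, ← Finset.card_union_of_disjoint]
  · congr 1
    ext A
    simp only [mixedPairs, Finset.mem_union, Finset.mem_filter, Finset.mem_powersetCard,
      Finset.subset_univ, true_and]
    tauto
  · rw [Finset.disjoint_left]
    intro A hA hA'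
    simp only [mixedPairs, Finset.mem_union, Finset.mem_filter, Finset.mem_powersetCard,
      Finset.subset_univ, true_and] at hA hA'
    rcases hA with hA | hA
    · exact hA.1.2.2 hA'.1.1
    · have h : A = ∅ := Finset.disjoint_self_iff_empty A |>.1
        (disjoint_compl_right.mono hA.1.1 hA'.1.1)
      simp [h] at hA
  · rw [Finset.disjoint_left]
    intro A hA hA'
    simp only [mixedPairs, Finset.mem_filter, Finset.mem_powersetCard] at hA hA'
    exact hA.1.2.1 hA'.1.1

lemma filter_powersetCard_notMem (S : Finset (Fin 5)) (j : Fin 5) :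
    (S.powersetCard 2).filter (fun A => j ∉ A) = (S.erase j).powersetCard 2 := by
  ext A
  simp only [Finset.mem_filter, Finset.mem_powersetCard, Finset.subset_erase]
  tauto

end NullFacedSimplex

lemma IsNullFacedSimplex.exists_affineBasis {P : Set Spacetime} (hP : IsNullFacedSimplex P) :
    ∃ b : AffineBasis (Fin 5) ℝ Spacetime, P = convexHull ℝ (Set.range b) := by
  obtain ⟨v, hv, rfl, -⟩ := hP
  exact ⟨⟨v, hv, affineSpan_range_eq_top hv⟩, rfl⟩

lemma IsNullFacedSimplex.isNullFaced {P : Set Spacetime} (hP : IsNullFacedSimplex P) :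
    IsNullFaced P := hP.choose_spec.2.2

theorem causal_structure_of_isNullFacedSimplex {P : Set Spacetime} (hP : IsNullFacedSimplex P) :
    {h | IsHyperface P h}.ncard = 5 ∧
    (∀ h, IsHyperface P h → Xor (IsPastHyperface P h) (IsFutureHyperface P h)) ∧
    {F | IsTwoFace P F}.ncard = 10 ∧
    {F | IsPastFutureFace P F}.ncard = 6 ∧
    (({h | IsPastHyperface P h}.ncard = 2 ∧ {h | IsFutureHyperface P h}.ncard = 3 ∧
        {F | IsPastPastFace P F}.ncard = 1 ∧ {F | IsFutureFutureFace P F}.ncard = 3) ∨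
      ({h | IsPastHyperface P h}.ncard = 3 ∧ {h | IsFutureHyperface P h}.ncard = 2 ∧
        {F | IsPastPastFace P F}.ncard = 3 ∧ {F | IsFutureFutureFace P F}.ncard = 1)) := by
  have hnull := hP.isNullFaced
  obtain ⟨b, rfl⟩ := hP.exists_affineBasis
  have hsing : ∀ (q : Set Spacetime → Prop) (S : Finset (Fin 5)),
      (∀ h, q h ↔ ∃ i ∈ S, h = simplexFace b {i}) → {h | q h}.ncard = S.card := by
    intro q S hq
    rw [ncard_simplexFaces (b := b) (𝒜 := S.image fun i => {i}),
      Finset.card_image_of_injective _ Finset.singleton_injective]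
    simp [hq]
  rw [hsing _ Finset.univ (by simpa using isHyperface_simplex_iff b),
    hsing _ _ (isPastHyperface_simplex_iff b), hsing _ _ (isFutureHyperface_simplex_iff hnull),
    ncard_simplexFaces isTwoFace_simplex_iff, ncard_simplexFaces isPastPastFace_simplex_iff,
    ncard_simplexFaces (isFutureFutureFace_simplex_iff hnull),
    ncard_simplexFaces (isPastFutureFace_simplex_iff hnull)]
  refine ⟨by simp,
    fun h hh => hh.xor_past_future (isConvexPolytope_of_affineBasis b).2 (hnull h hh),
    by simp [Nat.choose], ?_⟩
  have hmix := card_filter_mixedPairs (pastIndices b) fun _ => True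
  simp only [Finset.filter_true, Finset.card_powersetCard, Finset.card_compl, Finset.card_univ,
    Fintype.card_fin] at hmix ⊢
  rcases card_pastIndices hnull with h | h <;> rw [h] at hmix ⊢ <;> simp [Nat.choose] at hmix ⊢ <;>
    omega

/-- The 2d faces at vertex `j` are the pairs among the four indices other than `j`, and `4.choose 2
= 6`. -/
lemma ncard_pastFuture_vertex {b : AffineBasis (Fin 5) ℝ Spacetime}
    (hb : IsNullFaced (convexHull ℝ (Set.range b))) (j : Fin 5) :
    {F | IsPastFutureFace (convexHull ℝ (Set.range b)) F ∧ b j ∈ F}.ncard +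
      ((pastIndices b).erase j).card.choose 2 + ((pastIndices b)ᶜ.erase j).card.choose 2 = 6 ∧
    {F | IsPastPastFace (convexHull ℝ (Set.range b)) F ∧ b j ∈ F}.ncard =
      ((pastIndices b).erase j).card.choose 2 ∧
    {F | IsFutureFutureFace (convexHull ℝ (Set.range b)) F ∧ b j ∈ F}.ncard =
      ((pastIndices b)ᶜ.erase j).card.choose 2 := by
  rw [ncard_simplexFaces_vertex isPastPastFace_simplex_iff,
    ncard_simplexFaces_vertex (isFutureFutureFace_simplex_iff hb),
    ncard_simplexFaces_vertex (isPastFutureFace_simplex_iff hb), filter_powersetCard_notMem,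
    filter_powersetCard_notMem, Finset.card_powersetCard, Finset.card_powersetCard]
  refine ⟨?_, rfl, rfl⟩
  have := card_filter_mixedPairs (pastIndices b) fun A => j ∉ A
  rw [filter_powersetCard_notMem, filter_powersetCard_notMem, filter_powersetCard_notMem,
    Finset.card_powersetCard, Finset.card_powersetCard, Finset.card_powersetCard,
    Finset.card_erase_of_mem (Finset.mem_univ j), Finset.card_univ, Fintype.card_fin] at this
  exact this

/-- The four hyperfaces through the vertex split 2 + 2, with 4 past-future faces against 2 others,
or 3 + 1, with 3 against 3. -/
lemma vertex_excess_nonneg {b : AffineBasis (Fin 5) ℝ Spacetime}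
    (hb : IsNullFaced (convexHull ℝ (Set.range b))) (j : Fin 5) :
    {F | IsPastPastFace (convexHull ℝ (Set.range b)) F ∧ b j ∈ F}.ncard +
      {F | IsFutureFutureFace (convexHull ℝ (Set.range b)) F ∧ b j ∈ F}.ncard ≤
      {F | IsPastFutureFace (convexHull ℝ (Set.range b)) F ∧ b j ∈ F}.ncard := by
  obtain ⟨h1, h2, h3⟩ := ncard_pastFuture_vertex hb j
  rw [h2, h3]
  have hc : (pastIndices b)ᶜ.card = 5 - (pastIndices b).card := by simp [Finset.card_compl]
  rcases card_pastIndices hb with h | h <;> rw [h] at hc <;> by_cases hj : j ∈ pastIndices b <;>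
    simp [Finset.card_erase_of_mem, Finset.erase_eq_of_notMem, hj, h, hc] at h1 ⊢ <;>
    omega

/-- Removing an index of the larger class gives the splitting 2 + 2. -/
lemma exists_vertex_excess_pos {b : AffineBasis (Fin 5) ℝ Spacetime}
    (hb : IsNullFaced (convexHull ℝ (Set.range b))) : ∃ j,
    {F | IsPastPastFace (convexHull ℝ (Set.range b)) F ∧ b j ∈ F}.ncard +
      {F | IsFutureFutureFace (convexHull ℝ (Set.range b)) F ∧ b j ∈ F}.ncard <
      {F | IsPastFutureFace (convexHull ℝ (Set.range b)) F ∧ b j ∈ F}.ncard := by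
  have hc : (pastIndices b)ᶜ.card = 5 - (pastIndices b).card := by simp [Finset.card_compl]
  obtain ⟨j, hj⟩ : ∃ j, ((pastIndices b).erase j).card = 2 ∧
      ((pastIndices b)ᶜ.erase j).card = 2 := by
    rcases card_pastIndices hb with h | h <;> rw [h] at hc
    · obtain ⟨j, hj⟩ := Finset.card_pos.1 (by omega : 0 < (pastIndices b)ᶜ.card)
      rw [Finset.mem_compl] at hj
      exact ⟨j, by simp [hj, h], by simp [Finset.card_erase_of_mem, hj, hc]⟩
    · obtain ⟨j, hj⟩ := Finset.card_pos.1 (by omega : 0 < (pastIndices b).card)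
      exact ⟨j, by simp [hj, h], by simp [hj, hc]⟩
  obtain ⟨h1, h2, h3⟩ := ncard_pastFuture_vertex hb j
  refine ⟨j, ?_⟩
  rw [h2, h3]
  rw [hj.1, hj.2] at h1 ⊢
  simp [Nat.choose] at h1 ⊢
  omega

/-- Around a vertex at which some tile has a strict surplus of past-future faces, no other tile can
compensate. -/
theorem not_exists_tessellation_by_nullFacedSimplices :
    ¬ ∃ 𝒯, IsTessellation 𝒯 ∧ ∀ P ∈ 𝒯, IsNullFacedSimplex P := by
  rintro ⟨𝒯, h𝒯, hs⟩
  obtain ⟨P, hP, -⟩ : (0 : Spacetime) ∈ ⋃₀ 𝒯 := by rw [h𝒯.cover]; trivial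
  obtain ⟨b, rfl⟩ := (hs P hP).exists_affineBasis
  obtain ⟨j, hj⟩ := exists_vertex_excess_pos (hs _ hP).isNullFaced
  refine (vertex_balance h𝒯 (fun Q hQ => (hs Q hQ).isNullFaced) (b j)).not_gt
    (Finset.sum_lt_sum (fun Q hQ => ?_) ⟨convexHull ℝ (Set.range b), ?_, hj⟩)
  · rw [Set.Finite.mem_toFinset] at hQ
    obtain ⟨hQ, hv⟩ := hQ
    have hnull := (hs Q hQ).isNullFaced
    obtain ⟨b', rfl⟩ := (hs Q hQ).exists_affineBasis
    obtain ⟨i, hi⟩ := extremePoints_convexHull_subset hv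
    rw [← hi]
    exact vertex_excess_nonneg hnull i
  · rw [Set.Finite.mem_toFinset]
    exact ⟨hP, vertex_mem_extremePoints b j⟩

/-! ### Bipyramids over a tetrahedron -/

lemma AffineBasis.apply_eq_sum (e : AffineBasis (Fin 5) ℝ Spacetime) (f : Spacetime →ᵃ[ℝ] ℝ)
    (x : Spacetime) :
    f x = e.coord 0 x * f (e 0) + ∑ k : Fin 4, e.coord k.succ x * f (e k.succ) := by
  obtain ⟨a, r, h⟩ := exists_minkowski_affine f
  have h1 := e.sum_coord_apply_eq_one x
  have h2 : minkowski a x = ∑ i, e.coord i x * minkowski a (e i) := by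
    conv_lhs => rw [← e.linear_combination_coord_eq_self x]
    simp only [minkowski_sum_right, minkowski_smul_right]
  rw [← Fin.sum_univ_succ (fun i => e.coord i x * f (e i))]
  simp only [h, mul_sub, Finset.sum_sub_distrib, ← h2, ← Finset.sum_mul, h1, one_mul]

lemma affDim_mono {s t : Set Spacetime} (h : s ⊆ t) : affDim s ≤ affDim t :=
  Submodule.finrank_mono (vectorSpan_mono ℝ h)

lemma affDim_le_three {s : Set Spacetime} {a : Spacetime} (ha : a ≠ 0) {m : ℝ}
    (h : ∀ x ∈ s, minkowski a x = m) : affDim s ≤ 3 :=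
  (Submodule.finrank_mono (vectorSpan_le_ker h)).trans (finrank_ker_minkowskiDual ha).le

/-- A three-dimensional intersection would span both hyperplanes and so make them equal. -/
lemma affDim_inter_le_two {P h k : Set Spacetime} (hP : (interior P).Nonempty)
    (hh : IsHyperface P h) (hk : IsHyperface P k) (hne : h ≠ k) : affDim (h ∩ k) ≤ 2 := by
  obtain ⟨a, m, ha, -, e⟩ := hh.exists_normal hP
  obtain ⟨a', m', ha', -, e'⟩ := hk.exists_normal hP
  have h1 : ∀ x ∈ h ∩ k, minkowski a x = m := fun x hx =>
    (e ▸ hx.1 : x ∈ {x ∈ P | minkowski a x = m}).2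
  have h2 : ∀ x ∈ h ∩ k, minkowski a' x = m' := fun x hx =>
    (e' ▸ hx.2 : x ∈ {x ∈ P | minkowski a' x = m'}).2
  have h3 := affDim_le_three ha h1
  by_contra! hc
  obtain ⟨κ, hκ, rfl, rfl⟩ := hyperplane_unique (le_antisymm h3 hc) ha ha' h1 h2
  rw [sep_smul_eq rfl hκ] at e
  exact hne (e.trans e'.symm)

/-- The affine structure of a bipyramid `P` over a tetrahedron. The bases `up` and `down` consist of
an apex, with index `0`, and the vertices of the tetrahedron. -/
structure IsBipyramid (P : Set Spacetime) (up down : AffineBasis (Fin 5) ℝ Spacetime)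
    (w : Fin 4 → ℝ) : Prop where
  pos : ∀ k, 0 < w k
  base : ∀ k : Fin 4, up k.succ = down k.succ
  up_coord : ∀ k : Fin 4, up.coord k.succ (down 0) = 2 * w k
  down_coord : ∀ k : Fin 4, down.coord k.succ (up 0) = 2 * w k
  coord_zero : ∀ x, down.coord 0 x = -up.coord 0 x
  eq_convexHull : P = convexHull ℝ (Set.range up ∪ Set.range down)

/-- The side of a bipyramid through the apex of `e` and the vertices other than the one with
index `k`. -/
def bipyramidSide (P : Set Spacetime) (e : AffineBasis (Fin 5) ℝ Spacetime) (k : Fin 4) :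
    Set Spacetime := {x ∈ P | e.coord k.succ x = 0}

namespace IsBipyramid

variable {P : Set Spacetime} {up down : AffineBasis (Fin 5) ℝ Spacetime} {w : Fin 4 → ℝ}

lemma symm (h : IsBipyramid P up down w) : IsBipyramid P down up w where
  pos := h.pos
  base k := (h.base k).symm
  up_coord := h.down_coord
  down_coord := h.up_coord
  coord_zero x := by rw [h.coord_zero, neg_neg]
  eq_convexHull := by rw [h.eq_convexHull, Set.union_comm]

/-- An affine function is determined by its values on the basis `up`; the two sides agree at the
base vertices and at the apex. -/
lemma coord_eq (h : IsBipyramid P up down w) (k : Fin 4) (x : Spacetime) :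
    down.coord k.succ x = up.coord k.succ x + 2 * w k * up.coord 0 x := by
  rw [up.apply_eq_sum (down.coord k.succ) x, h.down_coord, Finset.sum_eq_single k]
  · rw [h.base, down.coord_apply_eq]; ring
  · intro j _ hj
    rw [h.base, down.coord_apply_ne (by simpa using hj.symm), mul_zero]
  · simp

lemma coord_nonneg (h : IsBipyramid P up down w) {x : Spacetime} (hx : x ∈ P) (k : Fin 4) :
    0 ≤ up.coord k.succ x := by
  obtain ⟨a, r, ha⟩ := exists_minkowski_affine (up.coord k.succ)
  rw [h.eq_convexHull] at hx
  have hv : ∀ v ∈ Set.range up ∪ Set.range down, minkowski a v ≤ r := by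
    suffices ∀ v ∈ Set.range up ∪ Set.range down, 0 ≤ up.coord k.succ v from fun v hv => by
      have := this v hv
      rw [ha] at this
      linarith
    have hup : ∀ i, 0 ≤ up.coord k.succ (up i) := fun i => by
      rw [up.coord_apply]; split_ifs <;> simp
    rintro _ (⟨i, rfl⟩ | ⟨i, rfl⟩)
    · exact hup i
    · induction i using Fin.cases with
      | zero => rw [h.up_coord]; have := h.pos k; positivity
      | succ i => rw [← h.base]; exact hup _
  have := le_of_mem_convexHull hv x hx
  rw [ha]; linarith

lemma mem_iff (h : IsBipyramid P up down w) (x : Spacetime) :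
    x ∈ P ↔ ∀ k : Fin 4, 0 ≤ up.coord k.succ x ∧ 0 ≤ down.coord k.succ x := by
  refine ⟨fun hx k => ⟨h.coord_nonneg hx k, h.symm.coord_nonneg hx k⟩, fun hx => ?_⟩
  rw [h.eq_convexHull]
  -- The sign of the apex coordinate decides which of the two simplices contains `x`.
  rcases le_total 0 (up.coord 0 x) with h0 | h0
  · refine convexHull_mono Set.subset_union_left ?_
    rw [up.convexHull_eq_nonneg_coord]
    intro i
    induction i using Fin.cases with
    | zero => exact h0
    | succ i => exact (hx i).1
  · refine convexHull_mono Set.subset_union_right ?_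
    rw [down.convexHull_eq_nonneg_coord]
    intro i
    induction i using Fin.cases with
    | zero => rw [h.coord_zero]; linarith
    | succ i => exact (hx i).2

lemma isConvexPolytope (h : IsBipyramid P up down w) : IsConvexPolytope P := by
  refine ⟨⟨_, (Set.finite_range up).union (Set.finite_range down), h.eq_convexHull⟩, ?_⟩
  rw [h.eq_convexHull]
  exact (isConvexPolytope_of_affineBasis up).2.mono
    (interior_mono (convexHull_mono Set.subset_union_left))

lemma simplex_subset (h : IsBipyramid P up down w) : convexHull ℝ (Set.range up) ⊆ P := by
  rw [h.eq_convexHull]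
  exact convexHull_mono Set.subset_union_left

lemma simplexFace_subset_side (h : IsBipyramid P up down w) {A : Finset (Fin 5)} {k : Fin 4}
    (hk : k.succ ∈ A) : simplexFace up A ⊆ bipyramidSide P up k := fun _ hx =>
  ⟨h.simplex_subset hx.1, hx.2 _ hk⟩

lemma vertex_mem_side_iff (h : IsBipyramid P up down w) (j : Fin 5) (k : Fin 4) :
    up j ∈ bipyramidSide P up k ↔ j ≠ k.succ := by
  refine ⟨?_, fun hj => ⟨h.simplex_subset (subset_convexHull ℝ _ ⟨j, rfl⟩),
    up.coord_apply_ne hj.symm⟩⟩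
  rintro ⟨-, h⟩ rfl
  simp at h

lemma apex_notMem_side (h : IsBipyramid P up down w) (k : Fin 4) :
    up 0 ∉ bipyramidSide P down k := fun hx => by
  have := hx.2
  rw [h.down_coord] at this
  have := h.pos k
  linarith

lemma isHyperface_side (h : IsBipyramid P up down w) (k : Fin 4) :
    IsHyperface P (bipyramidSide P up k) := by
  obtain ⟨a, r, ha⟩ := exists_minkowski_affine (up.coord k.succ)
  have he : bipyramidSide P up k = {x ∈ P | minkowski a x = r} := by
    ext x
    simp [bipyramidSide, ha, sub_eq_zero, eq_comm]
  have ha0 : a ≠ 0 := by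
    rintro rfl
    have h1 := ha (up k.succ)
    have h2 := ha (up 0)
    rw [minkowski_zero_left] at h1 h2
    rw [up.coord_apply_eq] at h1
    rw [up.coord_apply_ne (Fin.succ_ne_zero k)] at h2
    linarith
  refine ⟨?_, le_antisymm ?_ ?_⟩
  · rw [he]
    refine isExposed_of_le fun x hx => ?_
    have := h.coord_nonneg hx k
    rw [ha] at this
    linarith
  · rw [he]
    exact affDim_le_three ha0 fun x hx => hx.2
  · have := affDim_simplexFace up (A := {k.succ}) (d := 3) (by simp)
    rw [← this]
    exact affDim_mono (h.simplexFace_subset_side (by simp))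

lemma exists_eq_side (h : IsBipyramid P up down w) {f : Set Spacetime} (hf : IsHyperface P f) :
    ∃ k, f = bipyramidSide P up k ∨ f = bipyramidSide P down k := by
  have hP := h.isConvexPolytope
  choose a r ha using fun k : Fin 4 => exists_minkowski_affine (up.coord k.succ)
  choose a' r' ha' using fun k : Fin 4 => exists_minkowski_affine (down.coord k.succ)
  have hne : ∀ k, a k ≠ 0 ∧ a' k ≠ 0 := by
    refine fun k => ⟨fun e => ?_, fun e => ?_⟩
    · have h1 := ha k (up k.succ)
      have h2 := ha k (up 0)
      rw [e, minkowski_zero_left] at h1 h2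
      rw [up.coord_apply_eq] at h1
      rw [up.coord_apply_ne (Fin.succ_ne_zero k)] at h2
      linarith
    · have h1 := ha' k (down k.succ)
      have h2 := ha' k (down 0)
      rw [e, minkowski_zero_left] at h1 h2
      rw [down.coord_apply_eq] at h1
      rw [down.coord_apply_ne (Fin.succ_ne_zero k)] at h2
      linarith
  obtain ⟨i, hi⟩ := hf.exists_eq_inter hP.2 hP.convex (Sum.elim a a') (Sum.elim r r')
    (by rintro (k | k); exacts [(hne k).1, (hne k).2])
    (by intro x; rw [h.mem_iff]; simp [ha, ha', forall_and])
  rcases i with k | k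
  · exact ⟨k, Or.inl (by rw [hi]; ext x; simp [bipyramidSide, ha, sub_eq_zero, eq_comm])⟩
  · exact ⟨k, Or.inr (by rw [hi]; ext x; simp [bipyramidSide, ha', sub_eq_zero, eq_comm])⟩

lemma side_ne_side (h : IsBipyramid P up down w) {i k : Fin 4} (hik : i ≠ k) :
    bipyramidSide P up i ≠ bipyramidSide P up k := fun e => by
  have h1 := (h.vertex_mem_side_iff i.succ k).2 (by simpa using hik)
  rw [← e, h.vertex_mem_side_iff] at h1
  exact h1 rfl

/-- Two sides through the same apex meet in a triangle. -/
lemma isFaceBetween_sides (h : IsBipyramid P up down w) {i k : Fin 4} (hik : i ≠ k) :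
    IsFaceBetween P (bipyramidSide P up i) (bipyramidSide P up k)
      (bipyramidSide P up i ∩ bipyramidSide P up k) := by
  refine ⟨h.isHyperface_side i, h.isHyperface_side k, h.side_ne_side hik, rfl,
    le_antisymm (affDim_inter_le_two h.isConvexPolytope.2 (h.isHyperface_side i)
      (h.isHyperface_side k) (h.side_ne_side hik)) ?_⟩
  have := affDim_simplexFace up (A := {i.succ, k.succ}) (d := 2)
    (by rw [Finset.card_pair (by simpa using hik)])
  rw [← this]
  exact affDim_mono (Set.subset_inter (h.simplexFace_subset_side (by simp))
    (h.simplexFace_subset_side (by simp)))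

/-- Sides through opposite apices can meet in a triangle only if they belong to the same triangle
of the base. -/
lemma eq_of_affDim_eq_two (h : IsBipyramid P up down w) {i k : Fin 4}
    (h2 : affDim (bipyramidSide P down i ∩ bipyramidSide P up k) = 2) : i = k := by
  by_contra hik
  -- By `coord_eq`, the side `down i` forces the apex coordinate to be at most 0 and the side `up k`
  -- forces it to be at least 0. So the intersection lies in the base, where for `i ≠ k` it is
  -- contained in an edge.
  have hsub : bipyramidSide P down i ∩ bipyramidSide P up k ⊆
      simplexFace up {0, i.succ, k.succ} := by
    rintro x ⟨⟨hx, h1⟩, -, h2⟩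
    have e1 := h.coord_eq i x
    have e2 := h.coord_eq k x
    have n1 := h.coord_nonneg hx i
    have n2 := h.symm.coord_nonneg hx k
    have hi := h.pos i
    have hk := h.pos k
    have h0 : up.coord 0 x = 0 := by
      rw [h1] at e1
      rw [h2] at e2
      refine le_antisymm ?_ ?_ <;> by_contra! hc
      · have := mul_pos hi hc
        linarith
      · have := mul_neg_of_pos_of_neg hk hc
        linarith
    have h3 : up.coord i.succ x = 0 := by rw [h1, h0] at e1; linarith
    have hnn : ∀ j, 0 ≤ up.coord j x := by
      intro j
      induction j using Fin.cases with
      | zero => exact h0.ge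
      | succ j => exact h.coord_nonneg hx j
    refine ⟨by rw [up.convexHull_eq_nonneg_coord]; exact hnn, fun j hj => ?_⟩
    simp only [Finset.mem_insert, Finset.mem_singleton] at hj
    rcases hj with rfl | rfl | rfl
    exacts [h0, h3, h2]
  have := affDim_mono hsub
  rw [affDim_simplexFace up (d := 1), h2] at this
  · omega
  · rw [Finset.card_insert_of_notMem (by simp [Fin.succ_ne_zero, eq_comm]),
      Finset.card_pair (by simpa using hik)]

lemma exists_eq_of_past (h : IsBipyramid P up down w)
    (hup : ∀ k, IsFutureHyperface P (bipyramidSide P up k)) {f : Set Spacetime}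
    (hf : IsPastHyperface P f) : ∃ k, f = bipyramidSide P down k := by
  obtain ⟨k, rfl | e⟩ := h.exists_eq_side hf.1
  · exact (not_past_and_future h.isConvexPolytope.2 hf (hup k)).elim
  · exact ⟨k, e⟩

lemma exists_eq_of_future (h : IsBipyramid P up down w)
    (hdown : ∀ k, IsPastHyperface P (bipyramidSide P down k)) {f : Set Spacetime}
    (hf : IsFutureHyperface P f) : ∃ k, f = bipyramidSide P up k := by
  obtain ⟨k, e | rfl⟩ := h.exists_eq_side hf.1
  · exact ⟨k, e⟩
  · exact (not_past_and_future h.isConvexPolytope.2 (hdown k) hf).elim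

lemma exists_eq_of_pastFuture (h : IsBipyramid P up down w)
    (hup : ∀ k, IsFutureHyperface P (bipyramidSide P up k))
    (hdown : ∀ k, IsPastHyperface P (bipyramidSide P down k)) {F : Set Spacetime}
    (hF : IsPastFutureFace P F) :
    ∃ k, F = bipyramidSide P down k ∩ bipyramidSide P up k := by
  obtain ⟨f, g, ⟨-, -, -, rfl, h2⟩, hf, hg⟩ := hF
  obtain ⟨i, rfl⟩ := h.exists_eq_of_past hup hf
  obtain ⟨k, rfl⟩ := h.exists_eq_of_future hdown hg
  obtain rfl := h.eq_of_affDim_eq_two h2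
  exact ⟨i, rfl⟩

lemma isFutureFutureFace (h : IsBipyramid P up down w)
    (hup : ∀ k, IsFutureHyperface P (bipyramidSide P up k)) {i k : Fin 4} (hik : i ≠ k) :
    IsFutureFutureFace P (bipyramidSide P up i ∩ bipyramidSide P up k) :=
  ⟨_, _, h.isFaceBetween_sides hik, hup i, hup k⟩

lemma isPastPastFace (h : IsBipyramid P up down w)
    (hdown : ∀ k, IsPastHyperface P (bipyramidSide P down k)) {i k : Fin 4} (hik : i ≠ k) :
    IsPastPastFace P (bipyramidSide P down i ∩ bipyramidSide P down k) :=
  ⟨_, _, h.symm.isFaceBetween_sides hik, hdown i, hdown k⟩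

/-- A vertex of the base lies in at least two triangles that join an edge of the base to a given
apex. -/
lemma one_lt_ncard_of_base (h : IsBipyramid P up down w) {q : Set Spacetime → Prop}
    (hq : ∀ i k : Fin 4, i ≠ k → q (bipyramidSide P up i ∩ bipyramidSide P up k))
    (hq2 : ∀ F, q F → IsTwoFace P F) (j : Fin 4) :
    1 < {F | q F ∧ up j.succ ∈ F}.ncard := by
  obtain ⟨a, b, c, ha, hb, hc, hab, hac, hbc⟩ : ∃ a b c : Fin 4,
      j ≠ a ∧ j ≠ b ∧ j ≠ c ∧ a ≠ b ∧ a ≠ c ∧ b ≠ c := by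
    revert j; decide
  have hmem : ∀ i k : Fin 4, j ≠ i → j ≠ k →
      up j.succ ∈ bipyramidSide P up i ∩ bipyramidSide P up k := fun i k hi hk =>
    ⟨(h.vertex_mem_side_iff _ _).2 (by simpa using hi),
      (h.vertex_mem_side_iff _ _).2 (by simpa using hk)⟩
  rw [Set.one_lt_ncard_iff (h.isConvexPolytope.finite_twoFaces.subset fun F hF => hq2 F hF.1)]
  -- The vertex with index `c` lies in the first triangle but not in the second.
  refine ⟨_, _, ⟨hq a b hab, hmem a b ha hb⟩, ⟨hq a c hac, hmem a c ha hc⟩, fun e => ?_⟩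
  have h1 : up c.succ ∈ bipyramidSide P up a ∩ bipyramidSide P up b :=
    ⟨(h.vertex_mem_side_iff _ _).2 (by simpa using hac.symm),
      (h.vertex_mem_side_iff _ _).2 (by simpa using hbc.symm)⟩
  rw [e] at h1
  exact (h.vertex_mem_side_iff _ _).1 h1.2 rfl

/-- At each vertex of a bipyramid with a past and a future apex there are fewer past-future
triangles than others. -/
lemma vertex_excess_neg (h : IsBipyramid P up down w)
    (hup : ∀ k, IsFutureHyperface P (bipyramidSide P up k))
    (hdown : ∀ k, IsPastHyperface P (bipyramidSide P down k)) {v : Spacetime}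
    (hv : v ∈ P.extremePoints ℝ) :
    {F | IsPastFutureFace P F ∧ v ∈ F}.ncard <
      {F | IsPastPastFace P F ∧ v ∈ F}.ncard + {F | IsFutureFutureFace P F ∧ v ∈ F}.ncard := by
  have hfin := h.isConvexPolytope.finite_twoFaces
  have hfPP : {F | IsPastPastFace P F ∧ v ∈ F}.Finite := hfin.subset fun F hF => hF.1.isTwoFace
  have hfFF : {F | IsFutureFutureFace P F ∧ v ∈ F}.Finite :=
    hfin.subset fun F hF => hF.1.isTwoFace
  have hv' : (∃ j : Fin 4, v = up j.succ) ∨ v = up 0 ∨ v = down 0 := by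
    rw [h.eq_convexHull] at hv
    rcases extremePoints_convexHull_subset hv with ⟨i, rfl⟩ | ⟨i, rfl⟩
    · induction i using Fin.cases with
      | zero => exact Or.inr (Or.inl rfl)
      | succ i => exact Or.inl ⟨i, rfl⟩
    · induction i using Fin.cases with
      | zero => exact Or.inr (Or.inr rfl)
      | succ i => exact Or.inl ⟨i, (h.base i).symm⟩
  rcases hv' with ⟨j, rfl⟩ | rfl | rfl
  -- At a base vertex there are at least 2 + 2 faces of pure type, and at most three past-future
  -- ones since the base triangle opposite to the vertex is excluded.
  · have h1 := h.one_lt_ncard_of_base (q := IsFutureFutureFace P)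
      (fun i k hik => h.isFutureFutureFace hup hik) (fun F hF => hF.isTwoFace) j
    have h2 := h.symm.one_lt_ncard_of_base (q := IsPastPastFace P)
      (fun i k hik => h.isPastPastFace hdown hik) (fun F hF => hF.isTwoFace) j
    rw [← h.base] at h2
    have h3 : {F | IsPastFutureFace P F ∧ up j.succ ∈ F}.ncard ≤ 3 := by
      have hsub : {F | IsPastFutureFace P F ∧ up j.succ ∈ F} ⊆
          (fun k => bipyramidSide P down k ∩ bipyramidSide P up k) ''
            ((Finset.univ.erase j : Finset (Fin 4)) : Set (Fin 4)) := by
        rintro F ⟨hF, hj⟩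
        obtain ⟨k, rfl⟩ := h.exists_eq_of_pastFuture hup hdown hF
        refine ⟨k, ?_, rfl⟩
        have := (h.vertex_mem_side_iff _ _).1 hj.2
        simpa [eq_comm] using this
      refine (Set.ncard_le_ncard hsub (Set.toFinite _)).trans
        ((Set.ncard_image_le (Set.toFinite _)).trans ?_)
      rw [Set.ncard_coe_finset]
      simp
    omega
  -- Past-future faces lie on sides of both apices, hence contain neither apex.
  · have h1 : {F | IsPastFutureFace P F ∧ up 0 ∈ F} = ∅ := by
      refine Set.eq_empty_of_forall_notMem ?_
      rintro F ⟨hF, hj⟩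
      obtain ⟨k, rfl⟩ := h.exists_eq_of_pastFuture hup hdown hF
      exact h.apex_notMem_side k hj.1
    have h2 : 0 < {F | IsFutureFutureFace P F ∧ up 0 ∈ F}.ncard :=
      (Set.ncard_pos hfFF).2 ⟨_, h.isFutureFutureFace hup (zero_ne_one : (0 : Fin 4) ≠ 1),
        (h.vertex_mem_side_iff _ _).2 (Fin.succ_ne_zero _).symm,
        (h.vertex_mem_side_iff _ _).2 (Fin.succ_ne_zero _).symm⟩
    rw [h1, Set.ncard_empty]
    omega
  · have h1 : {F | IsPastFutureFace P F ∧ down 0 ∈ F} = ∅ := by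
      refine Set.eq_empty_of_forall_notMem ?_
      rintro F ⟨hF, hj⟩
      obtain ⟨k, rfl⟩ := h.exists_eq_of_pastFuture hup hdown hF
      exact h.symm.apex_notMem_side k hj.2
    have h2 : 0 < {F | IsPastPastFace P F ∧ down 0 ∈ F}.ncard :=
      (Set.ncard_pos hfPP).2 ⟨_, h.isPastPastFace hdown (zero_ne_one : (0 : Fin 4) ≠ 1),
        (h.symm.vertex_mem_side_iff _ _).2 (Fin.succ_ne_zero _).symm,
        (h.symm.vertex_mem_side_iff _ _).2 (Fin.succ_ne_zero _).symm⟩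
    rw [h1, Set.ncard_empty]
    omega

lemma isNullFaced (h : IsBipyramid P up down w)
    (hup : ∀ k, IsFutureHyperface P (bipyramidSide P up k))
    (hdown : ∀ k, IsPastHyperface P (bipyramidSide P down k)) : IsNullFaced P := by
  intro f hf
  obtain ⟨k, rfl | rfl⟩ := h.exists_eq_side hf
  · obtain ⟨-, n, c, hn, hc, -⟩ := hup k
    exact ⟨n, c, hn, hc⟩
  · obtain ⟨-, n, c, hn, hc, -⟩ := hdown k
    exact ⟨n, c, hn, hc⟩

end IsBipyramid

/-! ### Tetrahedral diamonds are bipyramids -/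

/-- Pairing an affine dependence with `u` isolates the coefficient of `q`, the only point off the
hyperplane `⟨u, ·⟩ = s`. -/
lemma affineIndependent_cons {b : Fin 4 → Spacetime} (hb : AffineIndependent ℝ b)
    {u q : Spacetime} {s : ℝ} (hs : ∀ k, minkowski u (b k) = s) (hq : minkowski u q ≠ s) :
    AffineIndependent ℝ (Fin.cons q b : Fin 5 → Spacetime) := by
  rw [affineIndependent_iff_of_fintype] at hb ⊢
  intro t ht h
  rw [Finset.weightedVSub_eq_linear_combination _ ht] at h
  simp only [Fin.sum_univ_succ (n := 4), Fin.cons_zero, Fin.cons_succ] at h ht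
  have h1 : minkowski u (t 0 • q + ∑ i : Fin 4, t i.succ • b i) = 0 := by
    rw [h]; simp [minkowski]
  rw [minkowski_add_right, minkowski_smul_right, minkowski_sum_right] at h1
  simp only [minkowski_smul_right, hs, ← Finset.sum_mul] at h1
  have h0 : t 0 = 0 := by
    have : t 0 * (minkowski u q - s) = 0 := by
      have : ∑ i : Fin 4, t i.succ = -t 0 := by linarith
      rw [this] at h1
      linarith
    exact (mul_eq_zero.1 this).resolve_right (sub_ne_zero.2 hq)
  rw [h0, zero_add] at ht
  rw [h0, zero_smul, zero_add] at h
  intro i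
  induction i using Fin.cases with
  | zero => exact h0
  | succ i =>
    refine hb (fun i => t i.succ) ht ?_ i
    rw [Finset.weightedVSub_eq_linear_combination _ ht]
    exact h

lemma affineMap_apply_sum {f : Spacetime →ᵃ[ℝ] ℝ} {b : Fin 4 → Spacetime} {w : Fin 4 → ℝ}
    (hw : ∑ j, w j = 1) : f (∑ j, w j • b j) = ∑ j, w j * f (b j) := by
  obtain ⟨a, r, h⟩ := exists_minkowski_affine f
  simp only [h, minkowski_sum_right, minkowski_smul_right, mul_sub, Finset.sum_sub_distrib,
    ← Finset.sum_mul, hw, one_mul]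

/-- The coordinate is `w k` at `c` and 0 at `c + u`, and `c` is the midpoint of the two apices. -/
lemma coord_opposite_apex {e : AffineBasis (Fin 5) ℝ Spacetime} {w : Fin 4 → ℝ}
    (hw : ∑ j, w j = 1) {c u : Spacetime} (hc : c = ∑ j : Fin 4, w j • e j.succ)
    (h0 : e 0 = c + u) (k : Fin 4) : e.coord k.succ (c - u) = 2 * w k := by
  have h1 : e.coord k.succ c = w k := by
    rw [hc, affineMap_apply_sum hw, Finset.sum_eq_single k]
    · rw [e.coord_apply_eq, mul_one]
    · intro j _ hj
      rw [e.coord_apply_ne (by simpa using hj.symm), mul_zero]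
    · simp
  have h2 : e.coord k.succ (c + u) = 0 := by
    rw [← h0, e.coord_apply_ne (Fin.succ_ne_zero k)]
  obtain ⟨a, r, h⟩ := exists_minkowski_affine (e.coord k.succ)
  rw [h] at h1 h2 ⊢
  rw [minkowski_add_right] at h2
  rw [minkowski_sub_right]
  linarith

/-- The apex coordinate is the height over the base measured by `⟨u, ·⟩`; comparing the two apices
shows that it changes sign between `up` and `down`. -/
lemma coord_zero_mul {e : AffineBasis (Fin 5) ℝ Spacetime} {u : Spacetime} {s : ℝ}
    (hs : ∀ k : Fin 4, minkowski u (e k.succ) = s) (x : Spacetime) :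
    e.coord 0 x * (minkowski u (e 0) - s) = minkowski u x - s := by
  have h1 := e.sum_coord_apply_eq_one x
  have h2 := e.apply_eq_sum (minkowskiDual u).toAffineMap x
  simp only [LinearMap.coe_toAffineMap, minkowskiDual_apply, hs, ← Finset.sum_mul] at h2
  rw [Fin.sum_univ_succ] at h1
  rw [h2, show ∑ k : Fin 4, e.coord k.succ x = 1 - e.coord 0 x by linarith]
  ring

/-- The functional of a hyperplane that contains a side of a simplex is proportional to the
opposite barycentric coordinate. -/
lemma minkowski_sub_eq_coord_mul {e : AffineBasis (Fin 5) ℝ Spacetime} {n : Spacetime} {d : ℝ}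
    {k : Fin 4} (h : ∀ j, j ≠ k.succ → minkowski n (e j) = d) (x : Spacetime) :
    minkowski n x - d = e.coord k.succ x * (minkowski n (e k.succ) - d) := by
  have h1 := e.sum_coord_apply_eq_one x
  have h2 : minkowski n x = ∑ i, e.coord i x * minkowski n (e i) := by
    conv_lhs => rw [← e.linear_combination_coord_eq_self x]
    simp only [minkowski_sum_right, minkowski_smul_right]
  have h3 : minkowski n x - d = ∑ i, e.coord i x * (minkowski n (e i) - d) := by
    simp only [mul_sub, Finset.sum_sub_distrib, ← h2, ← Finset.sum_mul, h1, one_mul]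
  rw [h3, Finset.sum_eq_single k.succ]
  · intro j _ hj
    rw [h j hj, sub_self, mul_zero]
  · simp

/-- Since `⟨n, u⟩ < 0` for a future-pointing null `n`, the opposite apex decides the type: `c - u`
lies on the past side of hyperplanes through `c + u`, and vice versa. -/
theorem IsTetrahedralDiamond.exists_isBipyramid {P : Set Spacetime}
    (hP : IsTetrahedralDiamond P) : ∃ up down w, IsBipyramid P up down w ∧
      (∀ k, IsFutureHyperface P (bipyramidSide P up k)) ∧
      ∀ k, IsPastHyperface P (bipyramidSide P down k) := by
  obtain ⟨b, w, c, u, hb, hu, horth, hw, hw1, hc, hlo, hhi, hPe⟩ := hP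
  set s := minkowski u (b 0) with hs
  have hsk : ∀ k, minkowski u (b k) = s := fun k => by
    have := horth k 0
    rw [minkowski_sub_right] at this
    linarith
  have hsc : minkowski u c = s := by
    rw [hc, minkowski_sum_right]
    simp only [minkowski_smul_right, hsk, ← Finset.sum_mul, hw1, one_mul]
  have hup0 : minkowski u (c + u) = s + minkowski u u := by rw [minkowski_add_right, hsc]
  have hdown0 : minkowski u (c - u) = s - minkowski u u := by rw [minkowski_sub_right, hsc]
  have huu := hu.1
  have hiu := affineIndependent_cons hb hsk (q := c + u) (by rw [hup0]; intro e; linarith)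
  have hid := affineIndependent_cons hb hsk (q := c - u) (by rw [hdown0]; intro e; linarith)
  let up : AffineBasis (Fin 5) ℝ Spacetime := ⟨_, hiu, affineSpan_range_eq_top hiu⟩
  let down : AffineBasis (Fin 5) ℝ Spacetime := ⟨_, hid, affineSpan_range_eq_top hid⟩
  have u0 : up 0 = c + u := rfl
  have uk : ∀ k : Fin 4, up k.succ = b k := fun k => rfl
  have d0 : down 0 = c - u := rfl
  have dk : ∀ k : Fin 4, down k.succ = b k := fun k => rfl
  have hbip : IsBipyramid P up down w := by
    refine ⟨hw, fun k => by rw [uk, dk], fun k => ?_, fun k => ?_, fun x => ?_, ?_⟩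
    · rw [d0]
      exact coord_opposite_apex hw1 (by simp only [uk, hc]) u0 k
    · have := coord_opposite_apex (e := down) (u := -u) hw1 (by simpa only [dk] using hc)
        (by rw [d0, sub_eq_add_neg]) k
      rw [u0, ← this, sub_neg_eq_add]
    · have h1 := coord_zero_mul (e := up) (u := u) (s := s) (fun k => by rw [uk, hsk]) x
      have h2 := coord_zero_mul (e := down) (u := u) (s := s) (fun k => by rw [dk, hsk]) x
      rw [u0, hup0] at h1
      rw [d0, hdown0] at h2
      have : (down.coord 0 x + up.coord 0 x) * minkowski u u = 0 := by linarith
      have := (mul_eq_zero.1 this).resolve_right huu.ne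
      linarith
    · rw [hPe]
      congr 1
      have e1 : Set.range up = insert (c + u) (Set.range b) := Fin.range_cons _ _
      have e2 : Set.range down = insert (c - u) (Set.range b) := Fin.range_cons _ _
      rw [e1, e2]
      ext x
      simp only [Set.mem_union, Set.mem_insert_iff, Set.mem_singleton_iff]
      tauto
  refine ⟨up, down, w, hbip, fun k => ?_, fun k => ?_⟩
  · obtain ⟨n, d, hn, hd⟩ := hhi k
    have hv : ∀ j, j ≠ k.succ → minkowski n (up j) = d := by
      intro j hj
      induction j using Fin.cases with
      | zero => exact hd _ (Set.mem_insert _ _)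
      | succ j => exact hd _ (Set.mem_insert_of_mem _ ⟨j, by simpa using hj, rfl⟩)
    have heq := minkowski_sub_eq_coord_mul hv
    have hpos : 0 < minkowski n (up k.succ) - d := by
      have h1 := heq (down 0)
      have h2 := hv 0 (Fin.succ_ne_zero k).symm
      rw [hbip.up_coord, d0, minkowski_sub_right] at h1
      rw [u0, minkowski_add_right] at h2
      have h3 := hn.minkowski_neg_of_timelike hu
      have hwk := hw k
      by_contra! hneg
      have := mul_nonpos_of_nonneg_of_nonpos (by positivity : 0 ≤ 2 * w k) hneg
      linarith
    refine ⟨hbip.isHyperface_side k, n, d, hn, fun x hx => ?_, fun x hx => ?_⟩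
    · have := heq x
      rw [hx.2, zero_mul] at this
      linarith
    · have h1 := heq x
      have h2 := mul_nonneg (hbip.coord_nonneg hx k) hpos.le
      linarith
  · obtain ⟨n, d, hn, hd⟩ := hlo k
    have hv : ∀ j, j ≠ k.succ → minkowski n (down j) = d := by
      intro j hj
      induction j using Fin.cases with
      | zero => exact hd _ (Set.mem_insert _ _)
      | succ j => exact hd _ (Set.mem_insert_of_mem _ ⟨j, by simpa using hj, rfl⟩)
    have heq := minkowski_sub_eq_coord_mul hv
    have hneg : minkowski n (down k.succ) - d < 0 := by
      have h1 := heq (up 0)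
      have h2 := hv 0 (Fin.succ_ne_zero k).symm
      rw [hbip.down_coord, u0, minkowski_add_right] at h1
      rw [d0, minkowski_sub_right] at h2
      have h3 := hn.minkowski_neg_of_timelike hu
      have hwk := hw k
      by_contra! hpos
      have := mul_nonneg (by positivity : 0 ≤ 2 * w k) hpos
      linarith
    refine ⟨hbip.symm.isHyperface_side k, n, d, hn, fun x hx => ?_, fun x hx => ?_⟩
    · have := heq x
      rw [hx.2, zero_mul] at this
      linarith
    · have h1 := heq x
      have h2 := mul_nonpos_of_nonneg_of_nonpos (hbip.symm.coord_nonneg hx k) hneg.le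
      linarith

/-- At any vertex of any tile, all tiles having this vertex contribute a strict deficit of
past-future faces. -/
theorem not_exists_tessellation_by_tetrahedralDiamonds :
    ¬ ∃ 𝒯, IsTessellation 𝒯 ∧ ∀ P ∈ 𝒯, IsTetrahedralDiamond P := by
  rintro ⟨𝒯, h𝒯, hd⟩
  obtain ⟨P, hP, hne⟩ : (0 : Spacetime) ∈ ⋃₀ 𝒯 := by rw [h𝒯.cover]; trivial
  obtain ⟨v, hv⟩ := (h𝒯.polytope P hP).isCompact.extremePoints_nonempty ⟨0, hne⟩
  have hnull : ∀ Q ∈ 𝒯, IsNullFaced Q := fun Q hQ =>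
    let ⟨_, _, _, h, h1, h2⟩ := (hd Q hQ).exists_isBipyramid
    h.isNullFaced h1 h2
  refine (vertex_balance h𝒯 hnull v).not_lt (Finset.sum_lt_sum_of_nonempty ⟨P, ?_⟩ fun Q hQ => ?_)
  · rw [Set.Finite.mem_toFinset]
    exact ⟨hP, hv⟩
  · rw [Set.Finite.mem_toFinset] at hQ
    obtain ⟨_, _, _, h, h1, h2⟩ := (hd Q hQ.1).exists_isBipyramid
    exact h.vertex_excess_neg h1 h2 hQ.2

theorem mainTheorem3 :
    -- the causal structure of null-faced 4-simplices
    (∀ P, IsNullFacedSimplex P →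
      {h | IsHyperface P h}.ncard = 5 ∧
      (∀ h, IsHyperface P h → Xor (IsPastHyperface P h) (IsFutureHyperface P h)) ∧
      {F | IsTwoFace P F}.ncard = 10 ∧
      {F | IsPastFutureFace P F}.ncard = 6 ∧
      (({h | IsPastHyperface P h}.ncard = 2 ∧ {h | IsFutureHyperface P h}.ncard = 3 ∧
          {F | IsPastPastFace P F}.ncard = 1 ∧ {F | IsFutureFutureFace P F}.ncard = 3) ∨
        ({h | IsPastHyperface P h}.ncard = 3 ∧ {h | IsFutureHyperface P h}.ncard = 2 ∧
          {F | IsPastPastFace P F}.ncard = 3 ∧ {F | IsFutureFutureFace P F}.ncard = 1))) ∧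
    -- the balance of dihedral incidences at each 2d face of a tessellation with null hyperfaces
    (∀ 𝒯, IsTessellation 𝒯 → (∀ P ∈ 𝒯, IsNullFaced P) →
      ∀ P ∈ 𝒯, ∀ F, IsTwoFace P F →
        {Q | Q ∈ 𝒯 ∧ IsTwoFace Q F}.Finite ∧
        {Q | Q ∈ 𝒯 ∧ IsPastFutureFace Q F}.ncard =
          {Q | Q ∈ 𝒯 ∧ IsPastPastFace Q F}.ncard +
          {Q | Q ∈ 𝒯 ∧ IsFutureFutureFace Q F}.ncard) ∧
    -- no tessellation by null-faced 4-simplices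
    (¬ ∃ 𝒯, IsTessellation 𝒯 ∧ ∀ P ∈ 𝒯, IsNullFacedSimplex P) ∧
    -- no tessellation by tetrahedral diamonds
    (¬ ∃ 𝒯, IsTessellation 𝒯 ∧ ∀ P ∈ 𝒯, IsTetrahedralDiamond P) :=
  ⟨fun _ hP => causal_structure_of_isNullFacedSimplex hP,
    fun _ h𝒯 hnull _ hP _ hF => balance_of_isTessellation h𝒯 hnull hP hF,
    not_exists_tessellation_by_nullFacedSimplices,
    not_exists_tessellation_by_tetrahedralDiamonds⟩
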